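/- Let $K\ge 1$ and let $\lambda_1,\dots,\lambda_K>0$ with $\sum_{k=1}^K\lambda_k=1$. For each $N$, consider $N$ strictly totally ordered candidates arriving in a uniformly random order $(x_1,\dots,x_N)$. Independently of this order, the groups $g_1,\dots,g_N\in\{1,\dots,K\}$ of the arriving candidates are i.i.d. with $\mathbf P(g_t=k)=\lambda_k$. For $T\ge 0$ and a budget $B\ge 0$, let $\mathcal A^B_T$ be the single-threshold algorithm: it rejects every candidate arriving at a step $t<T$; at a step $t\ge T$ it rejects $x_t$ if $x_t$ is not the best candidate so far within its own group; if $x_t$ is the best so far within its group, then it selects $x_t$ and stops when no budget is left, and otherwise it pays one unit of budget to learn whether $x_t$ is the best candidate seen so far among all groups, selecting $x_t$ and stopping if so and rejecting it if not. Rejections are irrevocable, and $\mathcal A^B_T$ succeeds if it selects the best of all $N$ candidates. Then for every $B\ge 0$ the limit $L_B:=\lim_{N\to\infty}\Pr\big(\mathcal A^B_{\lfloor N/e\rfloor}\text{ succeeds}\big)$ exists and satisfies $$L_B\;\ge\;\frac1e\left(1-\frac{(K-1)^{B+1}}{(B+1)!}\right).$$ Moreover $L_B\le \frac1e$ for every $B\ge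 0$, so that $L_B$ converges to $\frac1e$ as $B\to\infty$ at a factorial rate: $$\Big|L_B-\frac1e\Big|\le\frac1e\cdot\frac{(K-1)^{B+1}}{(B+1)!}\quad\text{for all }B\ge 0,\qquad \lim_{B\to\infty}L_B=\frac1e.$$ -/

import Mathlib

/-!
The multicolor secretary problem with a comparison budget. The `N` candidates arrive at the
steps `t : Fin N` (the index `t` is the step number `t + 1` of the usual 1-based count).
A permutation `x` gives the value `x t` of the candidate arriving at step `t`
(larger is better), and `g t : Fin K` is the group of that candidate.
-/

namespace Secretary

/-- In-group rank `r_t`: the number of candidates of the group of candidate `t`, observed up to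
and including step `t`, that are at least as good as candidate `t`. -/
def inGroupRank {N K : ℕ} (x : Equiv.Perm (Fin N)) (g : Fin N → Fin K) (t : Fin N) : ℕ :=
  (Finset.univ.filter fun s : Fin N => s ≤ t ∧ g s = g t ∧ x t ≤ x s).card

/-- Overall rank `R_t`: the number of candidates observed up to and including step `t` that are
at least as good as candidate `t`. -/
def overallRank {N : ℕ} (x : Equiv.Perm (Fin N)) (t : Fin N) : ℕ :=
  (Finset.univ.filter fun s : Fin N => s ≤ t ∧ x t ≤ x s).card

/-- Execution of the single-threshold algorithm with threshold `T` along a list of steps still to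
come, with `b` comparisons left. Candidates before step `T` (1-based), and candidates that are not
the best so far in their group, are skipped. A candidate that is the best so far in its group is
selected if no comparison is left; otherwise one comparison is paid, and the candidate is
selected if and only if it is the best so far overall. -/
def singleThresholdRun {N K : ℕ} (x : Equiv.Perm (Fin N)) (g : Fin N → Fin K) (T : ℕ) :
    ℕ → List (Fin N) → Option (Fin N)
  | _, [] => none
  | b, t :: ts =>
    if T ≤ (t : ℕ) + 1 ∧ inGroupRank x g t = 1 then
      match b with
      | 0 => some t
      | b' + 1 => if overallRank x t = 1 then some t else singleThresholdRun x g T b' ts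
    else singleThresholdRun x g T b ts

/-- The step at which the single-threshold algorithm with threshold `T` and budget `B` selects a
candidate (`none` if it never does). -/
def selectedStep {N K : ℕ} (x : Equiv.Perm (Fin N)) (g : Fin N → Fin K) (T B : ℕ) :
    Option (Fin N) :=
  singleThresholdRun x g T B (List.finRange N)

/-- The algorithm succeeds if it selects the best of all the candidates. -/
def Succeeds {N K : ℕ} (x : Equiv.Perm (Fin N)) (g : Fin N → Fin K) (T B : ℕ) : Prop :=
  ∃ t : Fin N, selectedStep x g T B = some t ∧ ∀ s : Fin N, x s ≤ x t

instance {N K : ℕ} (x : Equiv.Perm (Fin N)) (g : Fin N → Fin K) (T B : ℕ) :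
    Decidable (Succeeds x g T B) := by
  unfold Succeeds
  infer_instance

/-- Success probability of the single-threshold algorithm with threshold `T` and budget `B` on `N`
candidates, when the arrival order is uniformly random (each permutation has probability
`1 / N!`) and, independently of it, the groups of the candidates are independent with
`P(g_t = k) = lam k`. -/
noncomputable def successProb {K : ℕ} (lam : Fin K → ℝ) (B N T : ℕ) : ℝ :=
  ∑ x : Equiv.Perm (Fin N), ∑ g : Fin N → Fin K,
    if Succeeds x g T B then (1 / (Nat.factorial N : ℝ)) * ∏ t : Fin N, lam (g t) else 0

end Secretary

namespace Secretary

/-! Let `t` be the arrival step of the best candidate and `s` that of the best candidate before `t`.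
With 0-based steps and threshold `m + 1`, the algorithm succeeds exactly when `s < m ≤ t` and at
most `B` comparisons are spent on in-group records in `[m, t)` (`succeeds_iff`). The group of `s`
has no record there, since `s` beats everything before `t`; so only records of the other groups
count.

For fixed groups, `sum_perm_ite_top` gives the positions `t` and `s` the weight `1 / (N t)`, and the
record count outside the group of `s` is independent of them. This count is a sum of independent
indicators with success probabilities `1 / (c + 1)`, where `c` is the number of earlier members of
the group. Le Cam's inequality (`abs_recordProb_sub_poissonLt_le`) makes it nearly Poisson, and
harmonic sums turn its mean into a sum of `log (c_j(t) / c_j(m))` over the other groups `j`. By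
Chebyshev, `c_j(n)` is close to `λ_j n` at `n = m, t`, so `λ_j` cancels in the ratio and the mean is
close to `(K - 1) log (t / m)`.

Summing over `s < m ≤ t` gives `(m / N) ∑ 1 / t * P(Poisson((K - 1) log (t / m)) ≤ B)`, a Riemann
sum in `v = log (t / m)`. As `m / N → 1 / e` it tends to `(1 / e) ∫_0^1 P(Poisson((K - 1) v) ≤ B) dv
= L_B`. The integrand is at most `1`, and at least `1 - (K - 1)^(B + 1) / (B + 1)!` by the tail
bound `one_sub_le_poissonLt`; these are the two bounds on `L_B`. -/

open Finset Equiv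

/-! ### Relative ranks in a uniform permutation. -/

/-- Swapping two adjacent values does not change the order of the remaining ones. -/
theorem swap_castSucc_succ_lt_iff {n : ℕ} (p : Fin n) {i j : Fin (n + 1)}
    (hi : i ≠ p.castSucc) (hj : j ≠ p.castSucc) :
    swap p.castSucc p.succ i < swap p.castSucc p.succ j ↔ i < j := by
  have key : ∀ i : Fin (n + 1), i ≠ p.castSucc →
      (i = p.succ ∧ swap p.castSucc p.succ i = p.castSucc) ∨
      (i ≠ p.succ ∧ swap p.castSucc p.succ i = i) := by
    intro i hi
    by_cases h : i = p.succ
    · left; exact ⟨h, by rw [h, swap_apply_right]⟩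
    · right; exact ⟨h, swap_apply_of_ne_of_ne hi h⟩
  rcases key i hi with ⟨h1, h2⟩ | ⟨h1, h2⟩ <;> rcases key j hj with ⟨h3, h4⟩ | ⟨h3, h4⟩ <;>
    rw [h2, h4] <;> simp only [Fin.lt_def, Fin.ext_iff, Fin.val_castSucc, Fin.val_succ, ne_eq] at * <;>
    omega

/-- If `F` depends only on the values off `insert t S` and on the relative order on `S`, then
the event that `t` beats all of `S` is independent of `F`, of probability `1 / (|S| + 1)`. -/
theorem sum_perm_ite_top {N : ℕ} (S : Finset (Fin N)) (t : Fin N) (ht : t ∉ S)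
    (F : Perm (Fin N) → ℝ)
    (hF : ∀ x y : Perm (Fin N), (∀ a, a ∉ S → a ≠ t → x a = y a) →
      (∀ a ∈ S, ∀ b ∈ S, x a < x b ↔ y a < y b) → F x = F y) :
    ((S.card : ℝ) + 1) * ∑ x : Perm (Fin N), (if ∀ s ∈ S, x s < x t then F x else 0) =
      ∑ x : Perm (Fin N), F x := by
  set n := S.card with hn
  -- `V x` is the set of values taken on `insert t S`, `e x` its increasing enumeration, and `c j`
  -- below the part of the sum where `t` has rank `j` in it. All `c j` are shown to be equal; the
  -- top one is the sum over the event.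
  let V : Perm (Fin N) → Finset (Fin N) := fun x => (insert t S).map x.toEmbedding
  have hV : ∀ x, (V x).card = n + 1 := fun x => by
    simp only [V, card_map, card_insert_of_notMem ht, hn]
  let e : (x : Perm (Fin N)) → Fin (n + 1) ↪o Fin N := fun x => (V x).orderEmbOfFin (hV x)
  have he_mem : ∀ x i, e x i ∈ V x := fun x i => orderEmbOfFin_mem _ _ _
  have he_surj : ∀ x, ∀ a ∈ insert t S, ∃ i, e x i = x a := by
    intro x a ha
    have : x a ∈ Set.range (e x) := by
      rw [range_orderEmbOfFin]; exact mem_coe.2 (mem_map_of_mem _ ha)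
    exact this
  have hcongr : ∀ x y, V x = V y → e x = e y := by
    intro x y h
    simp only [e, h]
  let c : Fin (n + 1) → ℝ := fun j => ∑ x : Perm (Fin N), if x t = e x j then F x else 0
  -- Exchanging the values of ranks `p` and `p + 1` is an involution. If `t` holds one of them, at
  -- most one element of `S` moves, to a neighbouring rank, so the order on `S`, and hence `F`, is
  -- unchanged.
  have hstep : ∀ p : Fin n, c p.succ = c p.castSucc := by
    intro p
    let ψ : Perm (Fin N) → Perm (Fin N) := fun x => swap (e x p.castSucc) (e x p.succ) * x
    have hVψ : ∀ x, V (ψ x) = V x := by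
      intro x
      have hmap : V (ψ x) = (V x).map (swap (e x p.castSucc) (e x p.succ)).toEmbedding := by
        simp only [V, map_map]; rfl
      rw [hmap]
      apply Finset.eq_of_subset_of_card_le
      · intro v hv
        obtain ⟨u, hu, rfl⟩ := mem_map.1 hv
        rw [Equiv.coe_toEmbedding, swap_apply_def]
        split_ifs
        · exact he_mem _ _
        · exact he_mem _ _
        · exact hu
      · simp only [V, card_map, le_refl]
    have heψ : ∀ x, e (ψ x) = e x := fun x => hcongr _ _ (hVψ x)
    have hinv : Function.Involutive ψ := by
      intro x
      change swap (e (ψ x) p.castSucc) (e (ψ x) p.succ) * (ψ x) = x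
      rw [heψ]
      simp only [ψ, swap_mul_self_mul]
    have happ : ∀ x a i, x a = e x i → ψ x a = e x (swap p.castSucc p.succ i) := by
      intro x a i h
      simp only [ψ, Perm.mul_apply, h, swap_apply_def, (e x).injective.eq_iff]
      split_ifs <;> rfl
    simp only [c]
    rw [← Equiv.sum_comp hinv.toPerm]
    refine Finset.sum_congr rfl fun x _ => ?_
    change (if ψ x t = e (ψ x) p.succ then F (ψ x) else 0) = _
    rw [heψ]
    obtain ⟨i, hi⟩ := he_surj x t (mem_insert_self _ _)
    rw [happ x t i hi.symm, ← hi]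
    simp only [(e x).injective.eq_iff]
    have hiff : swap p.castSucc p.succ i = p.succ ↔ i = p.castSucc := by
      rw [Equiv.swap_apply_eq_iff, swap_apply_right]
    simp only [hiff]
    split_ifs with h
    · subst h
      symm
      apply hF
      · intro a ha hat
        simp only [ψ, Perm.mul_apply]
        have hne : ∀ i, x a ≠ e x i := by
          intro i hxa
          have := he_mem x i
          rw [← hxa] at this
          simp only [V, mem_map_equiv, symm_apply_apply, mem_insert] at this
          tauto
        rw [swap_apply_of_ne_of_ne (hne _) (hne _)]
      · intro a ha b hb
        obtain ⟨i, hia⟩ := he_surj x a (mem_insert_of_mem ha)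
        obtain ⟨j, hjb⟩ := he_surj x b (mem_insert_of_mem hb)
        rw [happ x a i hia.symm, happ x b j hjb.symm, ← hia, ← hjb, (e x).lt_iff_lt,
          (e x).lt_iff_lt, swap_castSucc_succ_lt_iff]
        · rintro rfl
          exact ht (by rwa [x.injective (hi.symm.trans hia)])
        · rintro rfl
          exact ht (by rwa [x.injective (hi.symm.trans hjb)])
    · rfl
  have hconst : ∀ j, c j = c (Fin.last n) := by
    intro j
    induction j using Fin.reverseInduction with
    | last => rfl
    | cast p ih => rw [← hstep p, ih]
  have htop : c (Fin.last n) = ∑ x : Perm (Fin N), (if ∀ s ∈ S, x s < x t then F x else 0) := by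
    refine Finset.sum_congr rfl fun x _ => ?_
    refine if_congr ?_ rfl rfl
    constructor
    · intro h s hs
      obtain ⟨i, hi⟩ := he_surj x s (mem_insert_of_mem hs)
      have hle : x s ≤ x t := by
        rw [h, ← hi]; exact (e x).monotone (Fin.le_last i)
      refine lt_of_le_of_ne hle fun hst => ht ?_
      rwa [← x.injective hst]
    · intro h
      have hmem := he_mem x (Fin.last n)
      obtain ⟨a, ha, hax⟩ := mem_map.1 hmem
      rw [Equiv.coe_toEmbedding] at hax
      rcases mem_insert.1 ha with rfl | ha'
      · exact hax
      · obtain ⟨i, hi⟩ := he_surj x t (mem_insert_self _ _)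
        have h1 := h a ha'
        rw [hax, ← hi, (e x).lt_iff_lt] at h1
        exact absurd h1 (Fin.le_last i).not_gt
  have hsum : ∑ j, c j = ∑ x : Perm (Fin N), F x := by
    simp only [c]
    rw [Finset.sum_comm]
    refine Finset.sum_congr rfl fun x _ => ?_
    obtain ⟨i, hi⟩ := he_surj x t (mem_insert_self _ _)
    simp only [← hi, (e x).injective.eq_iff, Finset.sum_ite_eq, Finset.mem_univ, if_true]
  rw [← htop, ← hsum, Finset.sum_congr rfl fun j _ => hconst j]
  simp

/-! ### Records and the combinatorial description of success. -/

/-- Candidate `r` is better than all the earlier candidates of its group. -/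
def IsRecord {N K : ℕ} (x : Perm (Fin N)) (g : Fin N → Fin K) (r : Fin N) : Prop :=
  ∀ a ∈ univ.filter (fun a : Fin N => a < r ∧ g a = g r), x a < x r

instance {N K : ℕ} (x : Perm (Fin N)) (g : Fin N → Fin K) (r : Fin N) :
    Decidable (IsRecord x g r) := by
  unfold IsRecord
  infer_instance

theorem inGroupRank_eq_one_iff {N K : ℕ} (x : Perm (Fin N)) (g : Fin N → Fin K) (r : Fin N) :
    inGroupRank x g r = 1 ↔ IsRecord x g r := by
  unfold inGroupRank IsRecord
  rw [card_eq_one]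
  constructor
  · rintro ⟨a, ha⟩ s hs
    have hr : r ∈ univ.filter fun s : Fin N => s ≤ r ∧ g s = g r ∧ x r ≤ x s := by simp
    rw [ha, mem_singleton] at hr
    subst hr
    simp only [mem_filter, mem_univ, true_and] at hs
    by_contra hlt
    have : s ∈ univ.filter fun s : Fin N => s ≤ r ∧ g s = g r ∧ x r ≤ x s := by
      simp [hs.1.le, hs.2, not_lt.1 hlt]
    rw [ha, mem_singleton] at this
    exact hs.1.ne this
  · intro h
    refine ⟨r, ?_⟩
    ext s
    simp only [mem_filter, mem_univ, true_and, mem_singleton] at h ⊢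
    constructor
    · rintro ⟨h1, h2, h3⟩
      by_contra hne
      exact absurd (h s ⟨lt_of_le_of_ne h1 hne, h2⟩) (not_lt.2 h3)
    · rintro rfl; simp

theorem overallRank_eq_one_iff {N : ℕ} (x : Perm (Fin N)) (r : Fin N) :
    overallRank x r = 1 ↔ ∀ a < r, x a < x r := by
  have h := inGroupRank_eq_one_iff x (fun _ => (0 : Fin 1)) r
  simpa [inGroupRank, overallRank, IsRecord] using h

/-- Along an increasing list of steps, the algorithm selects the best candidate `t` exactly when
`t` is active, no earlier active candidate is an overall record, and the comparisons suffice. -/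
theorem singleThresholdRun_eq_some_iff {N K : ℕ} (x : Perm (Fin N)) (g : Fin N → Fin K) (T : ℕ)
    (t : Fin N) (hmax : ∀ s, x s ≤ x t) (l : List (Fin N)) (hl : l.Pairwise (· < ·)) (b : ℕ) :
    singleThresholdRun x g T b l = some t ↔
      t ∈ l ∧ T ≤ (t : ℕ) + 1 ∧ (∀ r ∈ l, r < t → T ≤ (r : ℕ) + 1 → overallRank x r ≠ 1) ∧
      l.countP (fun r => r < t ∧ T ≤ (r : ℕ) + 1 ∧ inGroupRank x g r = 1) ≤ b := by
  induction l generalizing b with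
  | nil => simp [singleThresholdRun]
  | cons a l ih =>
    obtain ⟨hal, hl'⟩ := List.pairwise_cons.1 hl
    have hrec : ∀ r, overallRank x r = 1 → inGroupRank x g r = 1 := by
      intro r hr
      rw [inGroupRank_eq_one_iff]
      rw [overallRank_eq_one_iff] at hr
      intro a ha
      exact hr a (by simpa using (mem_filter.1 ha).2.1)
    have htmax : overallRank x t = 1 := by
      rw [overallRank_eq_one_iff]
      exact fun a ha => lt_of_le_of_ne (hmax a) fun h => ha.ne (x.injective h)
    by_cases hat : a = t
    · subst hat
      have hnot : ∀ r ∈ a :: l, ¬ r < a := by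
        intro r hr
        rcases List.mem_cons.1 hr with rfl | hr
        · exact lt_irrefl _
        · exact (hal r hr).not_gt
      have hcount : (a :: l).countP
          (fun r => r < a ∧ T ≤ (r : ℕ) + 1 ∧ inGroupRank x g r = 1) = 0 := by
        rw [List.countP_eq_zero]
        intro r hr
        simp [hnot r hr]
      have hmem : a ∉ l := fun h => lt_irrefl _ (hal a h)
      rw [hcount]
      simp only [singleThresholdRun, hrec a htmax, and_true, htmax, if_true]
      by_cases hT : T ≤ (a : ℕ) + 1
      · rw [if_pos hT]
        have hR : a ∈ a :: l ∧ T ≤ (a : ℕ) + 1 ∧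
            (∀ r ∈ a :: l, r < a → T ≤ (r : ℕ) + 1 → overallRank x r ≠ 1) ∧ 0 ≤ b :=
          ⟨List.mem_cons_self, hT, fun r hr h => absurd h (hnot r hr), Nat.zero_le _⟩
        refine iff_of_true ?_ hR
        -- The best candidate needs no budget of its own: without comparisons it is selected
        -- outright, and otherwise the comparison confirms it.
        cases b <;> rfl
      · rw [if_neg hT, ih hl']
        simp [hmem, hT]
    · have hta : t ≠ a := fun h => hat h.symm
      have hlt : t ∈ l → a < t := fun h => hal t h
      rw [List.countP_cons]
      simp only [singleThresholdRun]
      by_cases hact : T ≤ (a : ℕ) + 1 ∧ inGroupRank x g a = 1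
      · rw [if_pos hact]
        cases b with
        | zero =>
          simp only [Option.some.injEq, hat, false_iff]
          rintro ⟨h1, -, -, h4⟩
          have := hlt ((List.mem_cons.1 h1).resolve_left hta)
          simp [this, hact] at h4
        | succ b =>
          simp only
          by_cases ho : overallRank x a = 1
          · rw [if_pos ho]
            simp only [Option.some.injEq, hat, false_iff]
            rintro ⟨h1, -, h3, -⟩
            exact h3 a (List.mem_cons_self) (hlt ((List.mem_cons.1 h1).resolve_left hta)) hact.1 ho
          · rw [if_neg ho, ih hl']
            constructor
            · rintro ⟨h1, h2, h3, h4⟩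
              refine ⟨List.mem_cons_of_mem _ h1, h2, ?_, ?_⟩
              · intro r hr
                rcases List.mem_cons.1 hr with rfl | hr
                · exact fun _ _ => ho
                · exact h3 r hr
              · split_ifs <;> omega
            · rintro ⟨h1, h2, h3, h4⟩
              have h1' := (List.mem_cons.1 h1).resolve_left hta
              refine ⟨h1', h2, fun r hr => h3 r (List.mem_cons_of_mem _ hr), ?_⟩
              rw [if_pos (by simp [hlt h1', hact])] at h4
              omega
      · rw [if_neg hact, ih hl']
        have h0 : (if (decide (a < t ∧ T ≤ (a : ℕ) + 1 ∧ inGroupRank x g a = 1)) = true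
            then 1 else 0) = 0 := by
          rw [if_neg]; simp only [decide_eq_true_eq]; tauto
        rw [h0, add_zero]
        simp only [List.mem_cons, hta, false_or, forall_eq_or_imp]
        have : a < t → T ≤ (a : ℕ) + 1 → overallRank x a ≠ 1 :=
          fun _ h h' => hact ⟨h, hrec a h'⟩
        tauto

/-- The number of records in `[m, n)` outside group `k`. -/
def recordCount {N K : ℕ} (x : Perm (Fin N)) (g : Fin N → Fin K) (k : Fin K) (m n : ℕ) : ℕ :=
  (univ.filter fun r : Fin N => m ≤ (r : ℕ) ∧ (r : ℕ) < n ∧ g r ≠ k ∧ IsRecord x g r).card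

/-- Success means that the best candidate `t` is active, that the best candidate `s` before `t`
arrives before the threshold, and that the comparisons suffice. -/
theorem succeeds_iff {N K : ℕ} (x : Perm (Fin N)) (g : Fin N → Fin K) (m B : ℕ) (hm : 1 ≤ m) :
    Succeeds x g (m + 1) B ↔ ∃ t s : Fin N, (m ≤ (t : ℕ) ∧ (s : ℕ) < m) ∧
      (∀ a ∈ univ.erase t, x a < x t) ∧
      (∀ a ∈ (univ.filter (· < t)).erase s, x a < x s) ∧ recordCount x g (g s) m t < B + 1 := by
  have hmaxiff : ∀ t, (∀ a ∈ univ.erase t, x a < x t) ↔ ∀ s, x s ≤ x t := by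
    intro t
    constructor
    · intro h s
      by_cases hst : s = t
      · rw [hst]
      · exact (h s (by simp [hst])).le
    · intro h a ha
      exact lt_of_le_of_ne (h a) fun h' => by simp [x.injective h'] at ha
  -- An active in-group record before `t` cannot belong to the group of `s`, because `s` arrived
  -- before the threshold and is better. Hence discarding that group in `recordCount` loses nothing.
  have hcount : ∀ t s : Fin N, m ≤ (t : ℕ) → (s : ℕ) < m →
      (∀ a ∈ (univ.filter (· < t)).erase s, x a < x s) →
      (List.finRange N).countP
        (fun r => r < t ∧ m + 1 ≤ (r : ℕ) + 1 ∧ inGroupRank x g r = 1) =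
        recordCount x g (g s) m t := by
    intro t s hmt hsm hs
    unfold recordCount
    rw [List.countP_eq_length_filter, ← List.toFinset_card_of_nodup
      ((List.nodup_finRange N).filter _)]
    congr 1
    ext r
    simp only [List.toFinset_filter, mem_filter, List.mem_toFinset, List.mem_finRange, true_and,
      decide_eq_true_eq, mem_univ, inGroupRank_eq_one_iff, Fin.lt_def]
    constructor
    · rintro ⟨h1, h2, h3⟩
      refine ⟨by omega, h1, fun hg => ?_, h3⟩
      have hsr : s < r := by rw [Fin.lt_def]; omega
      have h4 := h3 s (by simp [hsr, hg])
      have h5 := hs r (by simp [hsr.ne', show r < t from h1])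
      exact absurd h4 h5.not_gt
    · rintro ⟨h1, h2, h3, h4⟩
      exact ⟨h2, by omega, h4⟩
  have hrun := fun t h => singleThresholdRun_eq_some_iff x g (m + 1) t h (List.finRange N)
    (List.pairwise_lt_finRange N) B
  unfold Succeeds selectedStep
  constructor
  · rintro ⟨t, h1, h2⟩
    obtain ⟨-, h3, h4, h5⟩ := (hrun t h2).1 h1
    -- Here `1 ≤ m` matters: it forces `t ≥ 1`, so that some candidate precedes `t`.
    have hne : (univ.filter (· < t)).Nonempty :=
      ⟨⟨0, by have := t.2; omega⟩, by
        simp only [mem_filter, mem_univ, true_and, Fin.lt_def]; omega⟩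
    obtain ⟨s, hs, hsmax⟩ := exists_max_image _ x hne
    have hs' : ∀ a ∈ (univ.filter (· < t)).erase s, x a < x s := by
      intro a ha
      rw [mem_erase] at ha
      exact lt_of_le_of_ne (hsmax a ha.2) fun h => ha.1 (x.injective h)
    have hst : s < t := by simpa using hs
    have hsm : (s : ℕ) < m := by
      by_contra hcon
      refine h4 s (List.mem_finRange s) hst (by omega) ?_
      rw [overallRank_eq_one_iff]
      exact fun a ha => hs' a (by simp [ha.ne, ha.trans hst])
    refine ⟨t, s, ⟨by omega, hsm⟩, (hmaxiff t).2 h2, hs', ?_⟩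
    rw [← hcount t s (by omega) hsm hs']
    omega
  · rintro ⟨t, s, ⟨hmt, hsm⟩, ht, hs, hc⟩
    have h2 := (hmaxiff t).1 ht
    refine ⟨t, (hrun t h2).2 ⟨List.mem_finRange t, by omega, ?_, ?_⟩, h2⟩
    · intro r _ hrt hmr ho
      rw [overallRank_eq_one_iff] at ho
      have hsr : s < r := by rw [Fin.lt_def]; omega
      exact absurd (ho s hsr) (hs r (by simp [hsr.ne', hrt])).not_gt
    · rw [hcount t s hmt hsm hs]
      omega

/-! ### Poisson distribution functions: Lipschitz, Taylor and tail bounds. -/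

/-- The probability that a Poisson variable of parameter `μ` is less than `b`. -/
noncomputable def poissonLt (b : ℕ) (μ : ℝ) : ℝ :=
  Real.exp (-μ) * ∑ j ∈ range b, μ ^ j / (j.factorial : ℝ)

theorem poissonLt_zero (μ : ℝ) : poissonLt 0 μ = 0 := by simp [poissonLt]

theorem poissonLt_succ_sub (b : ℕ) (μ : ℝ) :
    poissonLt (b + 1) μ - poissonLt b μ = Real.exp (-μ) * (μ ^ b / (b.factorial : ℝ)) := by
  simp only [poissonLt, sum_range_succ]; ring

theorem poissonLt_nonneg (b : ℕ) {μ : ℝ} (hμ : 0 ≤ μ) : 0 ≤ poissonLt b μ := by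
  unfold poissonLt; positivity

theorem poissonLt_le_one (b : ℕ) {μ : ℝ} (hμ : 0 ≤ μ) : poissonLt b μ ≤ 1 := by
  unfold poissonLt
  calc Real.exp (-μ) * ∑ j ∈ range b, μ ^ j / (j.factorial : ℝ)
      ≤ Real.exp (-μ) * Real.exp μ :=
        mul_le_mul_of_nonneg_left (Real.sum_le_exp_of_nonneg hμ b) (Real.exp_pos _).le
    _ = 1 := by rw [← Real.exp_add]; simp

theorem hasDerivAt_pow_succ_div_factorial (b : ℕ) (y : ℝ) :
    HasDerivAt (fun y : ℝ => y ^ (b + 1) / ((b + 1).factorial : ℝ))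
      (y ^ b / (b.factorial : ℝ)) y := by
  refine ((hasDerivAt_pow (b + 1) y).div_const ((b + 1).factorial : ℝ)).congr_deriv ?_
  have : (b.factorial : ℝ) ≠ 0 := by positivity
  rw [Nat.factorial_succ]; push_cast
  field_simp

theorem hasDerivAt_poissonLt_succ (b : ℕ) (μ : ℝ) :
    HasDerivAt (poissonLt (b + 1)) (poissonLt b μ - poissonLt (b + 1) μ) μ := by
  have hexp : HasDerivAt (fun y : ℝ => Real.exp (-y)) (-Real.exp (-μ)) μ := by
    simpa using (hasDerivAt_neg μ).exp
  have hsum : HasDerivAt (fun y : ℝ => ∑ j ∈ range (b + 1), y ^ j / (j.factorial : ℝ))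
      (∑ j ∈ range b, μ ^ j / (j.factorial : ℝ)) μ := by
    induction b with
    | zero => simpa using hasDerivAt_const μ (1 : ℝ)
    | succ b ih =>
      have h1 := hasDerivAt_pow_succ_div_factorial b μ
      rw [sum_range_succ]
      refine (ih.add h1).congr_of_eventuallyEq (Filter.Eventually.of_forall fun y => ?_)
      simp [sum_range_succ]
  refine HasDerivAt.congr_deriv (f := poissonLt (b + 1)) (hexp.mul hsum) ?_
  simp only [poissonLt]; ring

theorem differentiable_poissonLt (b : ℕ) : Differentiable ℝ (poissonLt b) := by
  unfold poissonLt
  fun_prop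

theorem abs_poissonLt_sub_le_one (b c : ℕ) {μ : ℝ} (hμ : 0 ≤ μ) :
    |poissonLt b μ - poissonLt c μ| ≤ 1 := by
  have := poissonLt_nonneg b hμ
  have := poissonLt_nonneg c hμ
  have := poissonLt_le_one b hμ
  have := poissonLt_le_one c hμ
  rw [abs_le]; constructor <;> linarith

/-- The derivative in the parameter is a difference of two numbers in `[0, 1]`, so the Lipschitz
constant is `1`. -/
theorem abs_poissonLt_sub_le (b : ℕ) {μ ν : ℝ} (hμ : 0 ≤ μ) (hν : 0 ≤ ν) :
    |poissonLt b ν - poissonLt b μ| ≤ |ν - μ| := by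
  cases b with
  | zero => simp [poissonLt_zero]
  | succ b =>
    have h := Convex.norm_image_sub_le_of_norm_hasDerivWithin_le (s := Set.Ici (0 : ℝ))
      (f := poissonLt (b + 1)) (f' := fun y => poissonLt b y - poissonLt (b + 1) y) (C := 1)
      (fun y _ => (hasDerivAt_poissonLt_succ b y).hasDerivWithinAt)
      (fun y hy => abs_poissonLt_sub_le_one _ _ hy) (convex_Ici 0) hμ hν
    simpa using h

/-- First-order Taylor estimate on the half-line for a function with Lipschitz derivative. -/
theorem abs_sub_sub_le_of_lipschitz_deriv {f f' : ℝ → ℝ} {C : ℝ}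
    (hf : ∀ y, 0 ≤ y → HasDerivAt f (f' y) y)
    (hL : ∀ y z, 0 ≤ y → y ≤ z → |f' z - f' y| ≤ C * (z - y))
    {a p : ℝ} (ha : 0 ≤ a) (hp : 0 ≤ p) (hC : 0 ≤ C) :
    |f (a + p) - f a - f' a * p| ≤ C * p ^ 2 := by
  have h := Convex.norm_image_sub_le_of_norm_hasDerivWithin_le (s := Set.Icc a (a + p))
    (f := fun y => f y - f' a * y) (f' := fun y => f' y - f' a) (C := C * p)
    (x := a) (y := a + p)
    (fun y hy => by
      have h1 := (hasDerivAt_id y).const_mul (f' a)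
      rw [mul_one] at h1
      exact ((hf y (ha.trans hy.1)).sub h1).hasDerivWithinAt)
    (fun y hy => (hL a y ha hy.1).trans (by
      apply mul_le_mul_of_nonneg_left _ hC; linarith [hy.2]))
    (convex_Icc _ _) ⟨le_refl _, by linarith⟩ ⟨by linarith, le_refl _⟩
  simp only [Real.norm_eq_abs, add_sub_cancel_left, abs_of_nonneg hp] at h
  convert h using 1
  · congr 1; ring
  · ring

/-- One step of Le Cam's argument: adding a Bernoulli variable of parameter `p` is, to first order
in `p`, raising the Poisson parameter by `p`. The constant `2` arises because the derivative is a
difference of two 1-Lipschitz functions. -/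
theorem abs_poissonLt_step_le (b : ℕ) {μ p : ℝ} (hμ : 0 ≤ μ) (hp : 0 ≤ p) :
    |poissonLt (b + 1) (μ + p) - ((1 - p) * poissonLt (b + 1) μ + p * poissonLt b μ)| ≤
      2 * p ^ 2 := by
  have h := abs_sub_sub_le_of_lipschitz_deriv (f := poissonLt (b + 1))
    (f' := fun y => poissonLt b y - poissonLt (b + 1) y) (C := 2)
    (fun y _ => hasDerivAt_poissonLt_succ b y) (fun y z hy hyz => by
      have hz := hy.trans hyz
      have h1 := abs_poissonLt_sub_le b hy hz
      have h2 := abs_poissonLt_sub_le (b + 1) hy hz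
      rw [abs_of_nonneg (sub_nonneg.2 hyz)] at h1 h2
      rw [abs_le] at *
      constructor <;> linarith [h1.1, h1.2, h2.1, h2.2]) hμ hp (by norm_num)
  convert h using 2
  ring

/-- Poisson tail bound `P(X ≥ b) ≤ μ ^ b / b!`. -/
theorem one_sub_le_poissonLt (b : ℕ) {μ : ℝ} (hμ : 0 ≤ μ) :
    1 - μ ^ b / (b.factorial : ℝ) ≤ poissonLt b μ := by
  cases b with
  | zero => simp [poissonLt_zero]
  | succ b =>
    -- `f 0 = 1` and the derivative of `f` is `(1 - exp (-y)) * y ^ b / b!`, which is nonnegative on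
    -- the half-line.
    let f : ℝ → ℝ := fun y => poissonLt (b + 1) y + y ^ (b + 1) / ((b + 1).factorial : ℝ)
    have hderiv : ∀ y, HasDerivAt f
        ((poissonLt b y - poissonLt (b + 1) y) + y ^ b / (b.factorial : ℝ)) y := by
      intro y
      exact (hasDerivAt_poissonLt_succ b y).add (hasDerivAt_pow_succ_div_factorial b y)
    have hmono : MonotoneOn f (Set.Ici 0) := by
      apply monotoneOn_of_deriv_nonneg (convex_Ici 0)
      · exact fun y _ => (hderiv y).continuousAt.continuousWithinAt
      · exact fun y _ => (hderiv y).differentiableAt.differentiableWithinAt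
      · intro y hy
        rw [interior_Ici] at hy
        rw [(hderiv y).deriv]
        have h1 := poissonLt_succ_sub b y
        have hy0 : (0 : ℝ) < y := hy
        have h2 : Real.exp (-y) ≤ 1 := Real.exp_le_one_iff.2 (by linarith)
        have h3 : 0 ≤ y ^ b / (b.factorial : ℝ) := by positivity
        nlinarith [mul_le_mul_of_nonneg_right h2 h3]
    have h := hmono (Set.mem_Ici.2 le_rfl) (Set.mem_Ici.2 hμ) hμ
    have h0 : f 0 = 1 := by
      simp [f, poissonLt, sum_range_succ']
    rw [h0] at h
    simp only [f] at h
    linarith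

/-! ### The record count for fixed groups: independence and Le Cam's inequality. -/

theorem isRecord_congr {N K : ℕ} {x y : Perm (Fin N)} {g : Fin N → Fin K} {r : Fin N}
    (h : ∀ a < r, g a = g r → (x a < x r ↔ y a < y r)) : IsRecord x g r ↔ IsRecord y g r := by
  unfold IsRecord
  refine forall₂_congr fun a ha => ?_
  simp only [mem_filter, mem_univ, true_and] at ha
  exact h a ha.1 ha.2

theorem recordCount_congr {N K : ℕ} {x y : Perm (Fin N)} {g : Fin N → Fin K} {k : Fin K} {m n : ℕ}
    (h : ∀ r : Fin N, (r : ℕ) < n → g r ≠ k → ∀ a < r, g a = g r → (x a < x r ↔ y a < y r)) :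
    recordCount x g k m n = recordCount y g k m n := by
  unfold recordCount
  congr 1
  refine filter_congr fun r _ => ?_
  constructor
  · rintro ⟨h1, h2, h3, h4⟩
    exact ⟨h1, h2, h3, (isRecord_congr (h r h2 h3)).1 h4⟩
  · rintro ⟨h1, h2, h3, h4⟩
    exact ⟨h1, h2, h3, (isRecord_congr (h r h2 h3)).2 h4⟩

/-- The number of candidates of group `k` among the first `n`. -/
def groupCount {N K : ℕ} (g : Fin N → Fin K) (k : Fin K) (n : ℕ) : ℕ :=
  (univ.filter fun a : Fin N => (a : ℕ) < n ∧ g a = k).card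

/-- The probability, for fixed groups, of fewer than `b` records in `[m, n)` outside group `k`. -/
noncomputable def recordProb {N K : ℕ} (g : Fin N → Fin K) (k : Fin K) (m n b : ℕ) : ℝ :=
  (∑ x : Perm (Fin N), if recordCount x g k m n < b then (1 : ℝ) else 0) / (N.factorial : ℝ)

/-- The sum of the `e`-th powers of the record probabilities in `[m, n)` outside group `k`. -/
noncomputable def recordIntensity {N K : ℕ} (g : Fin N → Fin K) (k : Fin K) (m n e : ℕ) : ℝ :=
  ∑ r : Fin N, if m ≤ (r : ℕ) ∧ (r : ℕ) < n ∧ g r ≠ k then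
    (1 / ((groupCount g (g r) r : ℝ) + 1)) ^ e else 0

theorem recordIntensity_nonneg {N K : ℕ} (g : Fin N → Fin K) (k : Fin K) (m n e : ℕ) :
    0 ≤ recordIntensity g k m n e := by
  unfold recordIntensity
  exact sum_nonneg fun r _ => by split_ifs <;> positivity

theorem recordIntensity_succ {N K : ℕ} (g : Fin N → Fin K) (k : Fin K) (m n e : ℕ) (hn : n < N) :
    recordIntensity g k m (n + 1) e = recordIntensity g k m n e +
      if m ≤ n ∧ g ⟨n, hn⟩ ≠ k then (1 / ((groupCount g (g ⟨n, hn⟩) n : ℝ) + 1)) ^ e else 0 := by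
  unfold recordIntensity
  have hsingle : (if m ≤ n ∧ g ⟨n, hn⟩ ≠ k then
      (1 / ((groupCount g (g ⟨n, hn⟩) n : ℝ) + 1)) ^ e else 0) =
      ∑ r : Fin N, if r = ⟨n, hn⟩ then (if m ≤ (r : ℕ) ∧ g r ≠ k then
      (1 / ((groupCount g (g r) r : ℝ) + 1)) ^ e else 0) else 0 := by
    rw [Finset.sum_ite_eq' univ]
    simp
  rw [hsingle, ← sum_add_distrib]
  refine sum_congr rfl fun r _ => ?_
  by_cases hr : r = ⟨n, hn⟩
  · subst hr; simp
  · have hne : (r : ℕ) ≠ n := fun h => hr (Fin.ext h)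
    have : (r : ℕ) < n + 1 ↔ (r : ℕ) < n := by omega
    simp [hr, this]

theorem recordCount_succ {N K : ℕ} (x : Perm (Fin N)) (g : Fin N → Fin K) (k : Fin K) (m n : ℕ)
    (hn : n < N) :
    recordCount x g k m (n + 1) = recordCount x g k m n +
      if (m ≤ n ∧ g ⟨n, hn⟩ ≠ k) ∧ IsRecord x g ⟨n, hn⟩ then 1 else 0 := by
  unfold recordCount
  simp only [card_filter]
  have hsingle : (if (m ≤ n ∧ g ⟨n, hn⟩ ≠ k) ∧ IsRecord x g ⟨n, hn⟩ then 1 else 0) =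
      ∑ r : Fin N, if r = ⟨n, hn⟩ then
        (if (m ≤ (r : ℕ) ∧ g r ≠ k) ∧ IsRecord x g r then 1 else 0) else 0 := by
    rw [Finset.sum_ite_eq' univ]
    simp
  rw [hsingle, ← sum_add_distrib]
  refine sum_congr rfl fun r _ => ?_
  by_cases hr : r = ⟨n, hn⟩
  · subst hr; simp [and_assoc]
  · have hne : (r : ℕ) ≠ n := fun h => hr (Fin.ext h)
    have : (r : ℕ) < n + 1 ↔ (r : ℕ) < n := by omega
    simp [hr, this]

theorem recordProb_zero_right {N K : ℕ} (g : Fin N → Fin K) (k : Fin K) (m n : ℕ) :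
    recordProb g k m n 0 = 0 := by simp [recordProb]

/-- The record indicator at step `n` is independent of the earlier in-group records. -/
theorem recordProb_succ {N K : ℕ} (g : Fin N → Fin K) (k : Fin K) (m n b : ℕ) (hn : n < N)
    (h : m ≤ n ∧ g ⟨n, hn⟩ ≠ k) :
    recordProb g k m (n + 1) (b + 1) =
      (1 - 1 / ((groupCount g (g ⟨n, hn⟩) n : ℝ) + 1)) * recordProb g k m n (b + 1) +
      1 / ((groupCount g (g ⟨n, hn⟩) n : ℝ) + 1) * recordProb g k m n b := by
  set r : Fin N := ⟨n, hn⟩ with hr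
  have hindep : ∀ c : ℕ, ((groupCount g (g r) n : ℝ) + 1) * ∑ x : Perm (Fin N),
      (if IsRecord x g r then (if recordCount x g k m n < c then (1 : ℝ) else 0) else 0) =
      ∑ x : Perm (Fin N), (if recordCount x g k m n < c then (1 : ℝ) else 0) := by
    intro c
    have := sum_perm_ite_top (univ.filter fun a : Fin N => a < r ∧ g a = g r) r (by simp)
      (fun x => if recordCount x g k m n < c then (1 : ℝ) else 0) (by
        intro x y hoff hon
        have : recordCount x g k m n = recordCount y g k m n := by
          -- Records in the group of `r` depend only on the order within the conditioning set;
          -- records in other groups only on values off it.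
          refine recordCount_congr fun q hq _ a haq hga => ?_
          have hqr : q < r := hq
          by_cases hg : g q = g r
          · exact hon a (by simp [haq.trans hqr, hga, hg]) q (by simp [hqr, hg])
          · rw [hoff a (by simp [hga, hg]) (haq.trans hqr).ne, hoff q (by simp [hg]) hqr.ne]
        simp only [this])
    exact this
  set p : ℝ := 1 / ((groupCount g (g r) n : ℝ) + 1) with hp
  have hpos : (groupCount g (g r) n : ℝ) + 1 ≠ 0 := by positivity
  have hindep' : ∀ c : ℕ, ∑ x : Perm (Fin N),
      (if IsRecord x g r then (if recordCount x g k m n < c then (1 : ℝ) else 0) else 0) =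
      p * ∑ x : Perm (Fin N), (if recordCount x g k m n < c then (1 : ℝ) else 0) := by
    intro c
    rw [← hindep c, hp, ← mul_assoc, one_div_mul_cancel hpos, one_mul]
  have hpoint : ∀ x : Perm (Fin N),
      (if recordCount x g k m (n + 1) < b + 1 then (1 : ℝ) else 0) =
      (if recordCount x g k m n < b + 1 then (1 : ℝ) else 0) -
      (if IsRecord x g r then (if recordCount x g k m n < b + 1 then (1 : ℝ) else 0) else 0) +
      (if IsRecord x g r then (if recordCount x g k m n < b then (1 : ℝ) else 0) else 0) := by
    intro x
    rw [recordCount_succ x g k m n hn]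
    by_cases hR : IsRecord x g r
    · simp [h, hR, ← hr]
    · simp [hR, ← hr]
  unfold recordProb
  simp only [hpoint, sum_add_distrib, sum_sub_distrib, hindep']
  ring

theorem recordProb_succ_of_not {N K : ℕ} (g : Fin N → Fin K) (k : Fin K) (m n b : ℕ) (hn : n < N)
    (h : ¬ (m ≤ n ∧ g ⟨n, hn⟩ ≠ k)) :
    recordProb g k m (n + 1) b = recordProb g k m n b := by
  unfold recordProb
  simp only [recordCount_succ _ g k m n hn, h, false_and, if_false, add_zero]

theorem recordProb_nonneg {N K : ℕ} (g : Fin N → Fin K) (k : Fin K) (m n b : ℕ) :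
    0 ≤ recordProb g k m n b := by
  unfold recordProb
  exact div_nonneg (sum_nonneg fun x _ => by split_ifs <;> norm_num) (by positivity)

theorem recordProb_le_one {N K : ℕ} (g : Fin N → Fin K) (k : Fin K) (m n b : ℕ) :
    recordProb g k m n b ≤ 1 := by
  unfold recordProb
  rw [div_le_one (by positivity)]
  calc ∑ x : Perm (Fin N), (if recordCount x g k m n < b then (1 : ℝ) else 0)
      ≤ ∑ x : Perm (Fin N), (1 : ℝ) := sum_le_sum fun x _ => by split_ifs <;> norm_num
    _ = N.factorial := by simp [Fintype.card_perm]

/-- Le Cam's inequality for the number of records. -/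
theorem abs_recordProb_sub_poissonLt_le {N K : ℕ} (g : Fin N → Fin K) (k : Fin K) (m n b : ℕ)
    (hn : n ≤ N) :
    |recordProb g k m n b - poissonLt b (recordIntensity g k m n 1)| ≤
      2 * recordIntensity g k m n 2 := by
  induction n generalizing b with
  | zero =>
    have h0 : ∀ e, recordIntensity g k m 0 e = 0 := by simp [recordIntensity]
    have h1 : ∀ x, recordCount x g k m 0 = 0 := by simp [recordCount]
    rw [h0, h0]
    have hN : (N.factorial : ℝ) ≠ 0 := by positivity
    cases b with
    | zero => simp [recordProb, poissonLt]
    | succ b =>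
      simp [recordProb, poissonLt, h1, Fintype.card_perm, sum_range_succ', hN]
  | succ n ih =>
    have hn' : n < N := hn
    cases b with
    | zero =>
      rw [recordProb_zero_right, poissonLt_zero]
      simpa using recordIntensity_nonneg g k m (n + 1) 2
    | succ b =>
      rw [recordIntensity_succ g k m n 1 hn', recordIntensity_succ g k m n 2 hn']
      by_cases h : m ≤ n ∧ g ⟨n, hn'⟩ ≠ k
      · rw [recordProb_succ g k m n b hn' h, if_pos h, if_pos h]
        have hp0 : 0 ≤ 1 / ((groupCount g (g ⟨n, hn'⟩) n : ℝ) + 1) := by positivity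
        have hp1 : 1 / ((groupCount g (g ⟨n, hn'⟩) n : ℝ) + 1) ≤ 1 := by
          rw [div_le_one (by positivity)]
          linarith [Nat.cast_nonneg (α := ℝ) (groupCount g (g ⟨n, hn'⟩) n)]
        rw [pow_one]
        generalize 1 / ((groupCount g (g ⟨n, hn'⟩) n : ℝ) + 1) = p at hp0 hp1 ⊢
        have h1 := ih (b + 1) hn'.le
        have h2 := ih b hn'.le
        have h3 := abs_poissonLt_step_le b (recordIntensity_nonneg g k m n 1) hp0
        rw [abs_le] at h1 h2 h3 ⊢
        -- The two inductive errors enter with weights `1 - p` and `p`, so they do not grow; only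
        -- the new term `2 * p ^ 2` is added.
        constructor <;> nlinarith [mul_le_mul_of_nonneg_left h1.1 (sub_nonneg.2 hp1),
          mul_le_mul_of_nonneg_left h1.2 (sub_nonneg.2 hp1),
          mul_le_mul_of_nonneg_left h2.1 hp0, mul_le_mul_of_nonneg_left h2.2 hp0]
      · rw [recordProb_succ_of_not g k m n _ hn' h, if_neg h, if_neg h, add_zero, add_zero]
        exact ih (b + 1) hn'.le

/-! ### Decomposition of the success probability over the two best positions. -/

/-- `sum_perm_ite_top` applies twice: `t` tops all `N` candidates, a condition independent of the
order before `t`; then `s` tops the `t` candidates before `t`, independently of the order among the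
others. The count outside the group of `s` sees only that last order. -/
theorem sum_perm_success_term {N K : ℕ} (g : Fin N → Fin K) (m b : ℕ) (t s : Fin N)
    (hst : s < t) :
    (∑ x : Perm (Fin N), if (∀ a ∈ univ.erase t, x a < x t) ∧
      (∀ a ∈ (univ.filter (· < t)).erase s, x a < x s) ∧ recordCount x g (g s) m t < b
      then (1 : ℝ) else 0) / (N.factorial : ℝ) =
      1 / (N : ℝ) * (1 / (t : ℝ)) * recordProb g (g s) m t b := by
  have hN : 0 < N := t.pos
  have ht : 0 < (t : ℕ) := lt_of_le_of_lt (Nat.zero_le _) hst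
  have h1 := sum_perm_ite_top (univ.erase t) t (by simp)
    (fun x => if ∀ a ∈ (univ.filter (· < t)).erase s, x a < x s then
      (if recordCount x g (g s) m t < b then (1 : ℝ) else 0) else 0) (by
    intro x y _ hon
    have hon' : ∀ a < t, ∀ c < t, (x a < x c ↔ y a < y c) := fun a ha c hc =>
      hon a (by simp [ha.ne]) c (by simp [hc.ne])
    have hc : recordCount x g (g s) m t = recordCount y g (g s) m t :=
      recordCount_congr fun r hr _ a har _ => hon' a (har.trans hr) r hr
    have hiff : (∀ a ∈ (univ.filter (· < t)).erase s, x a < x s) ↔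
        (∀ a ∈ (univ.filter (· < t)).erase s, y a < y s) := by
      refine forall₂_congr fun a ha => hon' a ?_ s hst
      simp only [mem_erase, mem_filter, mem_univ, true_and] at ha
      exact ha.2
    simp only [hc, hiff])
  have h2 := sum_perm_ite_top ((univ.filter (· < t)).erase s) s (by simp)
    (fun x => if recordCount x g (g s) m t < b then (1 : ℝ) else 0) (by
    intro x y hoff hon
    have hc : recordCount x g (g s) m t = recordCount y g (g s) m t := by
      refine recordCount_congr fun r hr hrs a har hga => ?_
      have hr' : r < t := hr
      refine hon a ?_ r ?_
      · simp only [mem_erase, mem_filter, mem_univ, true_and]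
        exact ⟨fun h => hrs (by rw [← hga, h]), har.trans hr'⟩
      · simp only [mem_erase, mem_filter, mem_univ, true_and]
        exact ⟨fun h => hrs (by rw [h]), hr'⟩
    simp only [hc])
  have hc1 : (((univ.erase t).card : ℕ) : ℝ) + 1 = N := by
    have : (univ.erase t).card + 1 = N := by
      rw [card_erase_add_one (mem_univ t)]; simp
    exact_mod_cast this
  have hc2 : ((((univ.filter (· < t)).erase s).card : ℕ) : ℝ) + 1 = (t : ℕ) := by
    have : ((univ.filter (· < t)).erase s).card + 1 = t := by
      have hI : univ.filter (· < t) = Iio t := by ext; simp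
      rw [card_erase_add_one (by simp [hst]), hI, Fin.card_Iio]
    exact_mod_cast this
  rw [hc1] at h1
  rw [hc2] at h2
  have hN' : (N : ℝ) ≠ 0 := by positivity
  have ht' : (((t : ℕ) : ℝ)) ≠ 0 := by positivity
  simp only [ite_and]
  unfold recordProb
  rw [← h2, ← h1]
  field_simp

theorem ite_exists_eq_sum_sum {α β : Type*} [Fintype α] [Fintype β] (P : α → β → Prop)
    [∀ a b, Decidable (P a b)] [Decidable (∃ a b, P a b)]
    (h : ∀ a b a' b', P a b → P a' b' → a = a' ∧ b = b') :
    (if ∃ a b, P a b then (1 : ℝ) else 0) = ∑ a, ∑ b, if P a b then (1 : ℝ) else 0 := by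
  classical
  by_cases hex : ∃ a b, P a b
  · rw [if_pos hex]
    obtain ⟨a, b, hab⟩ := hex
    rw [Finset.sum_eq_single a, Finset.sum_eq_single b, if_pos hab]
    · intro b' _ hb'
      rw [if_neg]
      exact fun h' => hb' (h _ _ _ _ h' hab).2
    · simp
    · intro a' _ ha'
      refine Finset.sum_eq_zero fun b' _ => ?_
      rw [if_neg]
      exact fun h' => ha' (h _ _ _ _ h' hab).1
    · simp
  · rw [if_neg hex]
    symm
    refine Finset.sum_eq_zero fun a _ => Finset.sum_eq_zero fun b _ => ?_
    rw [if_neg]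
    exact fun h' => hex ⟨a, b, h'⟩

/-- For fixed groups, the probability of success decomposes over the position `t` of the best
candidate and the position `s` of the best candidate before `t`. -/
theorem sum_perm_succeeds {N K : ℕ} (g : Fin N → Fin K) (m B : ℕ) (hm : 1 ≤ m) :
    (∑ x : Perm (Fin N), if Succeeds x g (m + 1) B then (1 : ℝ) else 0) / (N.factorial : ℝ) =
      ∑ t : Fin N, ∑ s : Fin N, if m ≤ (t : ℕ) ∧ (s : ℕ) < m then
        1 / (N : ℝ) * (1 / (t : ℝ)) * recordProb g (g s) m t (B + 1) else 0 := by
  classical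
  have hpoint : ∀ x : Perm (Fin N), (if Succeeds x g (m + 1) B then (1 : ℝ) else 0) =
      ∑ t : Fin N, ∑ s : Fin N, if m ≤ (t : ℕ) ∧ (s : ℕ) < m then
        (if (∀ a ∈ univ.erase t, x a < x t) ∧
          (∀ a ∈ (univ.filter (· < t)).erase s, x a < x s) ∧ recordCount x g (g s) m t < B + 1
          then (1 : ℝ) else 0) else 0 := by
    intro x
    simp only [← ite_and]
    rw [← ite_exists_eq_sum_sum]
    · exact if_congr (succeeds_iff x g m B hm) rfl rfl
    · rintro t s t' s' ⟨⟨h1, h2⟩, h3, h4, -⟩ ⟨⟨h1', h2'⟩, h3', h4', -⟩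
      have htt : t = t' := by
        by_contra hne
        exact lt_asymm (h3 t' (by simp [Ne.symm hne])) (h3' t (by simp [hne]))
      subst htt
      refine ⟨rfl, ?_⟩
      by_contra hne
      have hs : s < t := by rw [Fin.lt_def]; omega
      have hs' : s' < t := by rw [Fin.lt_def]; omega
      exact lt_asymm (h4 s' (by simp [Ne.symm hne, hs'])) (h4' s (by simp [hne, hs]))
  simp only [hpoint]
  rw [sum_comm, sum_div]
  refine sum_congr rfl fun t _ => ?_
  rw [sum_comm, sum_div]
  refine sum_congr rfl fun s _ => ?_
  by_cases h : m ≤ (t : ℕ) ∧ (s : ℕ) < m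
  · simp only [if_pos h]
    exact sum_perm_success_term g m (B + 1) t s (by rw [Fin.lt_def]; omega)
  · simp only [if_neg h, sum_const_zero, zero_div]

theorem successProb_eq {K : ℕ} (lam : Fin K → ℝ) (B N m : ℕ) (hm : 1 ≤ m) :
    successProb lam B N (m + 1) =
      ∑ t : Fin N, ∑ s : Fin N, if m ≤ (t : ℕ) ∧ (s : ℕ) < m then
        1 / (N : ℝ) * (1 / (t : ℝ)) *
          ∑ g : Fin N → Fin K, (∏ r, lam (g r)) * recordProb g (g s) m t (B + 1) else 0 := by
  have h1 : successProb lam B N (m + 1) = ∑ g : Fin N → Fin K, (∏ r, lam (g r)) *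
      ((∑ x : Perm (Fin N), if Succeeds x g (m + 1) B then (1 : ℝ) else 0) /
        (N.factorial : ℝ)) := by
    unfold successProb
    rw [sum_comm]
    refine sum_congr rfl fun g _ => ?_
    rw [sum_div, mul_sum]
    refine sum_congr rfl fun x _ => ?_
    split_ifs <;> ring
  rw [h1]
  simp only [sum_perm_succeeds _ m B hm, mul_sum]
  rw [sum_comm]
  refine sum_congr rfl fun t _ => ?_
  rw [sum_comm]
  refine sum_congr rfl fun s _ => ?_
  by_cases h : m ≤ (t : ℕ) ∧ (s : ℕ) < m
  · simp only [if_pos h]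
    refine sum_congr rfl fun g _ => ?_
    ring
  · simp only [if_neg h, mul_zero, sum_const_zero]

/-! ### Group sizes, and the record intensity as a sum of logarithms. -/

theorem groupCount_succ {N K : ℕ} (g : Fin N → Fin K) (k : Fin K) (n : ℕ) (hn : n < N) :
    groupCount g k (n + 1) = groupCount g k n + if g ⟨n, hn⟩ = k then 1 else 0 := by
  unfold groupCount
  simp only [card_filter]
  have hsingle : (if g ⟨n, hn⟩ = k then 1 else 0) =
      ∑ r : Fin N, if r = ⟨n, hn⟩ then (if g r = k then 1 else 0) else 0 := by
    rw [Finset.sum_ite_eq' univ]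
    simp
  rw [hsingle, ← sum_add_distrib]
  refine sum_congr rfl fun r _ => ?_
  by_cases hr : r = ⟨n, hn⟩
  · subst hr; simp
  · have hne : (r : ℕ) ≠ n := fun h => hr (Fin.ext h)
    have : (r : ℕ) < n + 1 ↔ (r : ℕ) < n := by omega
    simp [hr, this]

theorem groupCount_mono {N K : ℕ} (g : Fin N → Fin K) (k : Fin K) {m n : ℕ} (h : m ≤ n) :
    groupCount g k m ≤ groupCount g k n := by
  unfold groupCount
  refine card_le_card fun a ha => ?_
  simp only [mem_filter, mem_univ, true_and] at ha ⊢
  exact ⟨by omega, ha.2⟩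

/-- Each arrival changes one group size only. Taken with `log` and with the reciprocal as `φ`, this
lets the harmonic sums telescope within every group at once. -/
theorem sum_groupCount_succ {N K : ℕ} (φ : ℕ → ℝ) (g : Fin N → Fin K) (k : Fin K) (n : ℕ)
    (hn : n < N) :
    ∑ j ∈ univ.erase k, φ (groupCount g j (n + 1)) = ∑ j ∈ univ.erase k, φ (groupCount g j n) +
      if g ⟨n, hn⟩ ≠ k then
        φ (groupCount g (g ⟨n, hn⟩) n + 1) - φ (groupCount g (g ⟨n, hn⟩) n) else 0 := by
  have hsingle : (if g ⟨n, hn⟩ ≠ k then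
      φ (groupCount g (g ⟨n, hn⟩) n + 1) - φ (groupCount g (g ⟨n, hn⟩) n) else 0) =
      ∑ j ∈ univ.erase k, if g ⟨n, hn⟩ = j then
        φ (groupCount g j n + 1) - φ (groupCount g j n) else 0 := by
    rw [Finset.sum_ite_eq]
    simp
  rw [hsingle, ← sum_add_distrib]
  refine sum_congr rfl fun j _ => ?_
  rw [groupCount_succ g j n hn]
  by_cases hj : g ⟨n, hn⟩ = j <;> simp [hj]

/-- Both terms lie between `1 / (c + 1)` and `1 / c`. The bound is kept as a difference so that it
telescopes. -/
theorem abs_inv_succ_sub_log_le {c : ℝ} (hc : 0 < c) :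
    |1 / (c + 1) - (Real.log (c + 1) - Real.log c)| ≤ 1 / c - 1 / (c + 1) := by
  rw [← Real.log_div (by positivity) hc.ne']
  have h1 := Real.one_sub_inv_le_log_of_pos (x := (c + 1) / c) (by positivity)
  have h2 := Real.log_le_sub_one_of_pos (x := (c + 1) / c) (by positivity)
  have e1 : 1 - ((c + 1) / c)⁻¹ = 1 / (c + 1) := by field_simp; ring
  have e2 : (c + 1) / c - 1 = 1 / c := by field_simp; ring
  rw [e1] at h1
  rw [e2] at h2
  rw [abs_le]
  constructor <;> linarith

theorem inv_succ_sq_le {c : ℝ} (hc : 0 < c) : (1 / (c + 1)) ^ 2 ≤ 1 / c - 1 / (c + 1) := by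
  have e : 1 / c - 1 / (c + 1) = 1 / (c * (c + 1)) := by field_simp; ring
  rw [e, one_div_pow]
  apply one_div_le_one_div_of_le (by positivity)
  nlinarith

theorem recordIntensity_bounds {N K : ℕ} (g : Fin N → Fin K) (k : Fin K) {m t : ℕ}
    (hmt : m ≤ t) (ht : t ≤ N) (hpos : ∀ j, 1 ≤ groupCount g j m) :
    |recordIntensity g k m t 1 - ∑ j ∈ univ.erase k,
        (Real.log (groupCount g j t) - Real.log (groupCount g j m))| ≤
      ∑ j ∈ univ.erase k, 1 / (groupCount g j m : ℝ) ∧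
    recordIntensity g k m t 2 ≤ ∑ j ∈ univ.erase k, 1 / (groupCount g j m : ℝ) := by
  -- The induction needs the sharper bound with the reciprocal sizes at `t` subtracted: each step
  -- then pays exactly the decrease of the reciprocal.
  have main : |recordIntensity g k m t 1 - (∑ j ∈ univ.erase k, Real.log (groupCount g j t) -
        ∑ j ∈ univ.erase k, Real.log (groupCount g j m))| ≤
      ∑ j ∈ univ.erase k, 1 / (groupCount g j m : ℝ) -
        ∑ j ∈ univ.erase k, 1 / (groupCount g j t : ℝ) ∧
      recordIntensity g k m t 2 ≤ ∑ j ∈ univ.erase k, 1 / (groupCount g j m : ℝ) -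
        ∑ j ∈ univ.erase k, 1 / (groupCount g j t : ℝ) := by
    induction t, hmt using Nat.le_induction with
    | base =>
      have h0 : ∀ e, recordIntensity g k m m e = 0 := by
        intro e
        unfold recordIntensity
        refine sum_eq_zero fun r _ => ?_
        rw [if_neg]
        omega
      simp [h0]
    | succ n hmn ih =>
      have hn : n < N := ht
      obtain ⟨ih1, ih2⟩ := ih hn.le
      rw [recordIntensity_succ g k m n 1 hn, recordIntensity_succ g k m n 2 hn,
        sum_groupCount_succ (fun c => Real.log c) g k n hn,
        sum_groupCount_succ (fun c => 1 / (c : ℝ)) g k n hn]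
      by_cases hk : g ⟨n, hn⟩ ≠ k
      · have hc : 0 < (groupCount g (g ⟨n, hn⟩) n : ℝ) := by
          have := (hpos (g ⟨n, hn⟩)).trans (groupCount_mono g _ hmn)
          exact_mod_cast this
        have hmk : m ≤ n ∧ g ⟨n, hn⟩ ≠ k := ⟨hmn, hk⟩
        simp only [if_pos hmk, if_pos hk, pow_one]
        push_cast
        have h1 := abs_inv_succ_sub_log_le hc
        have h2 := inv_succ_sq_le hc
        rw [abs_le] at h1 ih1 ⊢
        refine ⟨⟨by linarith [h1.1, ih1.1], by linarith [h1.2, ih1.2]⟩, by linarith⟩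
      · have hmk : ¬ (m ≤ n ∧ g ⟨n, hn⟩ ≠ k) := fun h => hk h.2
        simp only [if_neg hmk, if_neg hk]
        simpa only [add_zero] using ⟨ih1, ih2⟩
  have hnn : 0 ≤ ∑ j ∈ univ.erase k, 1 / (groupCount g j t : ℝ) :=
    sum_nonneg fun j _ => by positivity
  rw [sum_sub_distrib]
  exact ⟨main.1.trans (by linarith), main.2.trans (by linarith)⟩

theorem abs_log_sub_log_le {u v ε : ℝ} (hv : 0 < v) (hε : ε ≤ 1 / 2)
    (h : |u - v| ≤ ε * v) : |Real.log u - Real.log v| ≤ 2 * ε := by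
  rw [abs_le] at h
  have hε0 : 0 ≤ ε := by
    by_contra hneg
    nlinarith [h.1, h.2, mul_neg_of_neg_of_pos (not_le.1 hneg) hv]
  have hu : 0 < u := by nlinarith
  rw [← Real.log_div hu.ne' hv.ne']
  have h1 := Real.one_sub_inv_le_log_of_pos (x := u / v) (by positivity)
  have h2 := Real.log_le_sub_one_of_pos (x := u / v) (by positivity)
  have h3 : u / v ≤ 1 + ε := by rw [div_le_iff₀ hv]; linarith
  -- This is where `ε ≤ 1 / 2` is used: `1 / (1 - ε) ≤ 1 + 2 ε`.
  have h4 : (u / v)⁻¹ ≤ 1 + 2 * ε := by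
    rw [inv_div, div_le_iff₀ hu]; nlinarith
  rw [abs_le]
  constructor <;> linarith

/-- When the group sizes are close to their means at the steps `m` and `t`, the number of records
is close to a Poisson variable. -/
theorem abs_recordProb_sub_le_of_good {N K : ℕ} (lam : Fin K → ℝ) {ℓ ε : ℝ} (hℓ : 0 < ℓ)
    (hlam : ∀ k, ℓ ≤ lam k) (hε0 : 0 ≤ ε) (hε : ε ≤ 1 / 2) (g : Fin N → Fin K) (k : Fin K)
    (b : ℕ) {m t : ℕ} (hm : 1 ≤ m) (hmt : m ≤ t) (ht : t ≤ N)
    (hgm : ∀ j, |(groupCount g j m : ℝ) - lam j * m| ≤ ε * (lam j * m))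
    (hgt : ∀ j, |(groupCount g j t : ℝ) - lam j * t| ≤ ε * (lam j * t)) :
    |recordProb g k m t b - poissonLt b (((K : ℝ) - 1) * Real.log (t / m))| ≤
      K * (4 * ε + 6 / (ℓ * m)) := by
  have hm0 : (0 : ℝ) < m := by exact_mod_cast hm
  have ht0 : (0 : ℝ) < t := by exact_mod_cast hm.trans hmt
  have hlpos : ∀ j, 0 < lam j := fun j => hℓ.trans_le (hlam j)
  have hlow : ∀ j, ℓ * m / 2 ≤ groupCount g j m := by
    intro j
    have h1 := (abs_le.1 (hgm j)).1
    have h2 : ℓ * m ≤ lam j * m := mul_le_mul_of_nonneg_right (hlam j) hm0.le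
    have h3 := mul_le_mul_of_nonneg_right hε (mul_pos (hlpos j) hm0).le
    linarith
  have hlm : 0 < ℓ * m := mul_pos hℓ hm0
  have hpos : ∀ j, 1 ≤ groupCount g j m := by
    intro j
    have : (0 : ℝ) < groupCount g j m := lt_of_lt_of_le (by positivity) (hlow j)
    exact_mod_cast this
  obtain ⟨h1, h2⟩ := recordIntensity_bounds g k hmt ht hpos
  have h3 := abs_recordProb_sub_poissonLt_le g k m t b ht
  have hK : 1 ≤ K := k.pos
  have hcard : ((univ.erase k).card : ℝ) = (K : ℝ) - 1 := by
    rw [card_erase_of_mem (mem_univ k), card_univ, Fintype.card_fin, Nat.cast_sub hK]; simp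
  have hinv : ∑ j ∈ univ.erase k, 1 / (groupCount g j m : ℝ) ≤ K * (2 / (ℓ * m)) := by
    calc ∑ j ∈ univ.erase k, 1 / (groupCount g j m : ℝ)
        ≤ ∑ j ∈ univ.erase k, 2 / (ℓ * m) := by
          refine sum_le_sum fun j _ => ?_
          have := one_div_le_one_div_of_le (by positivity) (hlow j)
          rwa [one_div_div] at this
      _ = ((K : ℝ) - 1) * (2 / (ℓ * m)) := by rw [sum_const, nsmul_eq_mul, hcard]
      _ ≤ K * (2 / (ℓ * m)) := by
          apply mul_le_mul_of_nonneg_right _ (by positivity); linarith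
  have hlog : |∑ j ∈ univ.erase k,
        (Real.log (groupCount g j t) - Real.log (groupCount g j m)) -
        ((K : ℝ) - 1) * Real.log (t / m)| ≤ K * (4 * ε) := by
    rw [← hcard, ← nsmul_eq_mul, ← sum_const, ← sum_sub_distrib]
    calc _ ≤ ∑ j ∈ univ.erase k,
          |Real.log (groupCount g j t) - Real.log (groupCount g j m) - Real.log (t / m)| :=
          abs_sum_le_sum_abs _ _
      _ ≤ ∑ j ∈ univ.erase k, 4 * ε := by
          refine sum_le_sum fun j _ => ?_
          have e1 := abs_log_sub_log_le (mul_pos (hlpos j) ht0) hε (hgt j)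
          have e2 := abs_log_sub_log_le (mul_pos (hlpos j) hm0) hε (hgm j)
          -- Splitting off `log (lam j)` at both times makes it cancel; this is why the limit does
          -- not depend on the group proportions. The two times contribute `2 * ε` each.
          rw [Real.log_mul (hlpos j).ne' ht0.ne'] at e1
          rw [Real.log_mul (hlpos j).ne' hm0.ne'] at e2
          rw [Real.log_div ht0.ne' hm0.ne']
          rw [abs_le] at *
          constructor <;> linarith [e1.1, e1.2, e2.1, e2.2]
      _ = ((K : ℝ) - 1) * (4 * ε) := by rw [sum_const, nsmul_eq_mul, hcard]
      _ ≤ K * (4 * ε) := by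
          apply mul_le_mul_of_nonneg_right _ (by positivity); linarith
  have hQ := abs_poissonLt_sub_le b (μ := ((K : ℝ) - 1) * Real.log (t / m))
    (ν := recordIntensity g k m t 1)
    (mul_nonneg (by rw [← hcard]; positivity)
      (Real.log_nonneg (by rw [one_le_div hm0]; exact_mod_cast hmt)))
    (recordIntensity_nonneg g k m t 1)
  -- The `6` is `2 * 2` from Le Cam's inequality plus `2` from replacing harmonic sums by
  -- logarithms.
  have hfin : (K : ℝ) * (4 * ε + 6 / (ℓ * m)) =
      2 * (K * (2 / (ℓ * m))) + (K * (4 * ε) + K * (2 / (ℓ * m))) := by ring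
  rw [hfin]
  have t1 := abs_sub_le (recordProb g k m t b) (poissonLt b (recordIntensity g k m t 1))
    (poissonLt b (((K : ℝ) - 1) * Real.log (t / m)))
  have t2 := abs_sub_le (recordIntensity g k m t 1) (∑ j ∈ univ.erase k,
        (Real.log (groupCount g j t) - Real.log (groupCount g j m)))
        (((K : ℝ) - 1) * Real.log (t / m))
  linarith

/-! ### Random groups: product weights and concentration of the group sizes. -/

theorem sum_weight_mul_prod {N K : ℕ} (lam : Fin K → ℝ) (f : Fin N → Fin K → ℝ) :
    ∑ g : Fin N → Fin K, (∏ r, lam (g r)) * ∏ r, f r (g r) = ∏ r, ∑ k, lam k * f r k := by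
  rw [prod_univ_sum, Fintype.piFinset_univ]
  refine sum_congr rfl fun g _ => ?_
  rw [prod_mul_distrib]

theorem sum_weight_eq_one {N K : ℕ} (lam : Fin K → ℝ) (hsum : ∑ k, lam k = 1) :
    ∑ g : Fin N → Fin K, (∏ r, lam (g r)) = 1 := by
  have h := sum_weight_mul_prod (N := N) lam (fun _ _ => 1)
  simpa [hsum] using h

theorem sum_weight_mul_apply {N K : ℕ} (lam : Fin K → ℝ) (hsum : ∑ k, lam k = 1) (a : Fin N)
    (φ : Fin K → ℝ) :
    ∑ g : Fin N → Fin K, (∏ r, lam (g r)) * φ (g a) = ∑ k, lam k * φ k := by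
  have h := sum_weight_mul_prod lam (fun r k => if r = a then φ k else 1)
  have h1 : ∀ g : Fin N → Fin K, (∏ r, if r = a then φ (g r) else 1) = φ (g a) := by
    intro g; rw [prod_ite_eq' univ]; simp
  have h2 : ∀ r : Fin N, (∑ k, lam k * if r = a then φ k else 1) =
      if r = a then ∑ k, lam k * φ k else 1 := by
    intro r; split_ifs <;> simp [hsum]
  simp only [h1, h2] at h
  rw [h, prod_ite_eq' univ]; simp

theorem sum_weight_mul_apply_mul_apply {N K : ℕ} (lam : Fin K → ℝ) (hsum : ∑ k, lam k = 1)
    {a b : Fin N} (hab : a ≠ b) (φ ψ : Fin K → ℝ) :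
    ∑ g : Fin N → Fin K, (∏ r, lam (g r)) * (φ (g a) * ψ (g b)) =
      (∑ k, lam k * φ k) * ∑ k, lam k * ψ k := by
  have h := sum_weight_mul_prod lam
    (fun r k => (if r = a then φ k else 1) * (if r = b then ψ k else 1))
  have h1 : ∀ g : Fin N → Fin K,
      (∏ r, (if r = a then φ (g r) else 1) * (if r = b then ψ (g r) else 1)) =
        φ (g a) * ψ (g b) := by
    intro g; rw [prod_mul_distrib, prod_ite_eq' univ, prod_ite_eq' univ]; simp
  have h2 : ∀ r : Fin N,
      (∑ k, lam k * ((if r = a then φ k else 1) * (if r = b then ψ k else 1))) =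
      (if r = a then ∑ k, lam k * φ k else 1) * (if r = b then ∑ k, lam k * ψ k else 1) := by
    intro r
    by_cases ha : r = a
    · subst ha; simp [hab]
    · by_cases hb : r = b
      · subst hb; simp [ha]
      · simp [ha, hb, hsum]
  simp only [h1, h2] at h
  rw [h, prod_mul_distrib, prod_ite_eq' univ, prod_ite_eq' univ]; simp

/-- The binomial variance: distinct steps are uncorrelated, and each contributes `lam k - lam k ^ 2
≤ lam k`. -/
theorem sum_weight_mul_sq_groupCount_sub_le {N K : ℕ} (lam : Fin K → ℝ) (hsum : ∑ k, lam k = 1)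
    (k : Fin K) (j : ℕ) (hj : j ≤ N) :
    ∑ g : Fin N → Fin K, (∏ r, lam (g r)) * ((groupCount g k j : ℝ) - lam k * j) ^ 2 ≤
      lam k * j := by
  let X : Fin K → ℝ := fun i => (if i = k then 1 else 0) - lam k
  let S : Finset (Fin N) := univ.filter fun a => (a : ℕ) < j
  have hS : S.card = j := by
    simp only [S, Fin.card_filter_val_lt, min_eq_right hj]
  have hX : ∀ g : Fin N → Fin K, (groupCount g k j : ℝ) - lam k * j = ∑ a ∈ S, X (g a) := by
    intro g
    simp only [X, sum_sub_distrib, sum_const, hS, nsmul_eq_mul, groupCount]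
    rw [sum_boole, filter_filter]
    ring
  have hmean : ∑ i, lam i * X i = 0 := by
    simp only [X, mul_sub, sum_sub_distrib, ← sum_mul, hsum]
    simp
  have hvar : ∑ i, lam i * (X i * X i) ≤ lam k := by
    have : ∀ i, lam i * (X i * X i) =
        (1 - 2 * lam k) * (if i = k then lam i else 0) + lam k ^ 2 * lam i := by
      intro i; simp only [X]; split_ifs <;> ring
    simp only [this, sum_add_distrib, ← mul_sum, hsum, sum_ite_eq', mem_univ, if_true]
    nlinarith [sq_nonneg (lam k)]
  have hexp : ∀ g : Fin N → Fin K,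
      (∏ r, lam (g r)) * ((groupCount g k j : ℝ) - lam k * j) ^ 2 =
      ∑ a ∈ S, ∑ b ∈ S, (∏ r, lam (g r)) * (X (g a) * X (g b)) := by
    intro g
    rw [hX, sq, sum_mul_sum, mul_sum]
    simp only [mul_sum]
  simp only [hexp]
  rw [sum_comm]
  calc ∑ a ∈ S, ∑ g : Fin N → Fin K, ∑ b ∈ S, (∏ r, lam (g r)) * (X (g a) * X (g b))
      ≤ ∑ a ∈ S, lam k := by
        refine sum_le_sum fun a ha => ?_
        rw [sum_comm, sum_eq_single_of_mem a ha]
        · exact (sum_weight_mul_apply lam hsum a fun i => X i * X i).trans_le hvar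
        · intro b _ hb
          rw [sum_weight_mul_apply_mul_apply lam hsum hb.symm, hmean, zero_mul]
    _ = lam k * j := by rw [sum_const, hS, nsmul_eq_mul, mul_comm]

/-- Chebyshev's inequality for the group sizes. -/
theorem sum_weight_bad_le {N K : ℕ} (lam : Fin K → ℝ) (hpos : ∀ k, 0 < lam k)
    (hsum : ∑ k, lam k = 1) (k : Fin K) (j : ℕ) (hj0 : 1 ≤ j) (hj : j ≤ N) {ε : ℝ} (hε : 0 < ε) :
    ∑ g : Fin N → Fin K, (∏ r, lam (g r)) *
      (if |(groupCount g k j : ℝ) - lam k * j| ≤ ε * (lam k * j) then 0 else 1) ≤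
      1 / (ε ^ 2 * (lam k * j)) := by
  have hj' : (0 : ℝ) < j := by exact_mod_cast hj0
  have hd : 0 < lam k * j := mul_pos (hpos k) hj'
  set d := lam k * j with hd'
  have h := sum_weight_mul_sq_groupCount_sub_le lam hsum k j hj
  calc _ ≤ ∑ g : Fin N → Fin K, (∏ r, lam (g r)) * ((groupCount g k j : ℝ) - d) ^ 2 *
        (1 / (ε * d) ^ 2) := by
        refine sum_le_sum fun g _ => ?_
        rw [mul_assoc]
        refine mul_le_mul_of_nonneg_left ?_ (prod_nonneg fun r _ => (hpos _).le)
        split_ifs with hc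
        · positivity
        · rw [mul_one_div, one_le_div (by positivity), ← sq_abs ((groupCount g k j : ℝ) - d)]
          exact pow_le_pow_left₀ (by positivity) (not_le.1 hc).le 2
    _ ≤ d * (1 / (ε * d) ^ 2) := by
        rw [← sum_mul]
        exact mul_le_mul_of_nonneg_right h (by positivity)
    _ = 1 / (ε ^ 2 * d) := by field_simp

/-- The excluded group `g s` is itself random, but the estimate on good group sizes is uniform in
the group, so no conditioning is needed. On bad sizes the difference is at most `1`, and a union
bound over the `K` groups at the two times `m` and `t` gives the last term. -/
theorem abs_sum_weight_recordProb_sub_le {N K : ℕ} (lam : Fin K → ℝ) (hpos : ∀ k, 0 < lam k)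
    (hsum : ∑ k, lam k = 1) {ℓ ε : ℝ} (hℓ : 0 < ℓ) (hlam : ∀ k, ℓ ≤ lam k) (hε0 : 0 < ε)
    (hε : ε ≤ 1 / 2) (s : Fin N) (b : ℕ) {m t : ℕ} (hm : 1 ≤ m) (hmt : m ≤ t) (ht : t ≤ N) :
    |∑ g : Fin N → Fin K, (∏ r, lam (g r)) * recordProb g (g s) m t b -
        poissonLt b (((K : ℝ) - 1) * Real.log (t / m))| ≤
      K * (4 * ε + 6 / (ℓ * m)) + 2 * (K * (1 / (ε ^ 2 * (ℓ * m)))) := by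
  have hm0 : (0 : ℝ) < m := by exact_mod_cast hm
  set Q := poissonLt b (((K : ℝ) - 1) * Real.log (t / m)) with hQ
  set A : ℝ := K * (4 * ε + 6 / (ℓ * m)) with hA
  have hA0 : 0 ≤ A := by positivity
  let bad : (Fin N → Fin K) → ℕ → Fin K → ℝ := fun g j k =>
    if |(groupCount g k j : ℝ) - lam k * j| ≤ ε * (lam k * j) then 0 else 1
  have hbad0 : ∀ g j k, 0 ≤ bad g j k := fun g j k => by
    simp only [bad]; split_ifs <;> norm_num
  have hw : ∀ g : Fin N → Fin K, 0 ≤ ∏ r, lam (g r) := fun g =>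
    prod_nonneg fun r _ => (hpos _).le
  have hlog : 0 ≤ Real.log ((t : ℝ) / m) :=
    Real.log_nonneg (by rw [one_le_div hm0]; exact_mod_cast hmt)
  have hpoint : ∀ g : Fin N → Fin K, |recordProb g (g s) m t b - Q| ≤
      A + (∑ k, bad g m k + ∑ k, bad g t k) := by
    intro g
    have hs0 : ∀ j, 0 ≤ ∑ k, bad g j k := fun j => sum_nonneg fun k _ => hbad0 g j k
    have hK : (1 : ℝ) ≤ K := by exact_mod_cast (g s).pos
    have htriv : |recordProb g (g s) m t b - Q| ≤ 1 := by
      have h1 := recordProb_nonneg g (g s) m t b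
      have h2 := recordProb_le_one g (g s) m t b
      have hnn : 0 ≤ ((K : ℝ) - 1) * Real.log (t / m) := mul_nonneg (by linarith) hlog
      have h3 := poissonLt_nonneg b hnn
      have h4 := poissonLt_le_one b hnn
      rw [abs_le]
      constructor <;> linarith
    have hone : ∀ j k, ¬ |(groupCount g k j : ℝ) - lam k * j| ≤ ε * (lam k * j) →
        1 ≤ ∑ k, bad g j k := by
      intro j k hk
      calc (1 : ℝ) = bad g j k := by simp only [bad, if_neg hk]
        _ ≤ _ := single_le_sum (f := fun k => bad g j k) (fun k _ => hbad0 g j k) (mem_univ k)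
    by_cases hgm : ∀ k, |(groupCount g k m : ℝ) - lam k * m| ≤ ε * (lam k * m)
    · by_cases hgt : ∀ k, |(groupCount g k t : ℝ) - lam k * t| ≤ ε * (lam k * t)
      · have := abs_recordProb_sub_le_of_good lam hℓ hlam hε0.le hε g (g s) b hm hmt ht hgm hgt
        linarith [hs0 m, hs0 t]
      · push Not at hgt
        obtain ⟨k, hk⟩ := hgt
        linarith [hs0 m, hone t k (not_le.2 hk)]
    · push Not at hgm
      obtain ⟨k, hk⟩ := hgm
      linarith [hs0 t, hone m k (not_le.2 hk)]
  have hbadsum : ∀ j : ℕ, m ≤ j → j ≤ N →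
      ∑ g : Fin N → Fin K, (∏ r, lam (g r)) * ∑ k, bad g j k ≤ K * (1 / (ε ^ 2 * (ℓ * m))) := by
    intro j hmj hjN
    simp only [mul_sum]
    rw [sum_comm]
    calc _ ≤ ∑ k : Fin K, 1 / (ε ^ 2 * (ℓ * m)) := by
          refine sum_le_sum fun k _ => ?_
          refine (sum_weight_bad_le lam hpos hsum k j (hm.trans hmj) hjN hε0).trans ?_
          have hmj' : (m : ℝ) ≤ j := by exact_mod_cast hmj
          have := hlam k
          have := (hpos k).le
          gcongr
      _ = K * (1 / (ε ^ 2 * (ℓ * m))) := by simp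
  have hsub : ∑ g : Fin N → Fin K, (∏ r, lam (g r)) * recordProb g (g s) m t b - Q =
      ∑ g : Fin N → Fin K, (∏ r, lam (g r)) * (recordProb g (g s) m t b - Q) := by
    simp only [mul_sub, sum_sub_distrib, ← sum_mul, sum_weight_eq_one lam hsum, one_mul]
  rw [hsub]
  calc _ ≤ ∑ g : Fin N → Fin K, |(∏ r, lam (g r)) * (recordProb g (g s) m t b - Q)| :=
        abs_sum_le_sum_abs _ _
    _ ≤ ∑ g : Fin N → Fin K, (∏ r, lam (g r)) * (A + (∑ k, bad g m k + ∑ k, bad g t k)) := by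
        refine sum_le_sum fun g _ => ?_
        rw [abs_mul, abs_of_nonneg (hw g)]
        exact mul_le_mul_of_nonneg_left (hpoint g) (hw g)
    _ = A + (∑ g : Fin N → Fin K, (∏ r, lam (g r)) * ∑ k, bad g m k +
          ∑ g : Fin N → Fin K, (∏ r, lam (g r)) * ∑ k, bad g t k) := by
        simp only [mul_add, sum_add_distrib, ← sum_mul, sum_weight_eq_one lam hsum, one_mul]
    _ ≤ _ := by
        have h1 := hbadsum m le_rfl (hmt.trans ht)
        have h2 := hbadsum t hmt ht
        linarith

/-! ### The Poisson integral and its Riemann sums. -/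

/-- The integral of the Poisson probabilities `P(Poisson(c v) < b)` over `v ∈ [0, w]`. -/
noncomputable def poissonIntegral (b : ℕ) (c w : ℝ) : ℝ := ∫ v in (0 : ℝ)..w, poissonLt b (c * v)

theorem continuous_poissonLt_mul (b : ℕ) (c : ℝ) : Continuous fun v => poissonLt b (c * v) :=
  (differentiable_poissonLt b).continuous.comp (continuous_const.mul continuous_id)

theorem hasDerivAt_poissonIntegral (b : ℕ) (c w : ℝ) :
    HasDerivAt (poissonIntegral b c) (poissonLt b (c * w)) w :=
  ((continuous_poissonLt_mul b c).integral_hasStrictDerivAt 0 w).hasDerivAt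

theorem poissonIntegral_one_le {b : ℕ} {c : ℝ} (hc : 0 ≤ c) : poissonIntegral b c 1 ≤ 1 := by
  have h := intervalIntegral.integral_mono_on (μ := MeasureTheory.volume) (zero_le_one (α := ℝ))
    ((continuous_poissonLt_mul b c).intervalIntegrable 0 1)
    (continuous_const (y := (1 : ℝ)).intervalIntegrable 0 1)
    (fun v hv => poissonLt_le_one b (mul_nonneg hc hv.1))
  simpa [poissonIntegral] using h

theorem le_poissonIntegral_one {b : ℕ} {c : ℝ} (hc : 0 ≤ c) :
    1 - c ^ b / (b.factorial : ℝ) ≤ poissonIntegral b c 1 := by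
  have h := intervalIntegral.integral_mono_on (μ := MeasureTheory.volume) (zero_le_one (α := ℝ))
    (continuous_const (y := 1 - c ^ b / (b.factorial : ℝ)).intervalIntegrable 0 1)
    ((continuous_poissonLt_mul b c).intervalIntegrable 0 1)
    (fun v hv => by
      refine le_trans ?_ (one_sub_le_poissonLt b (mul_nonneg hc hv.1))
      have h1 : (c * v) ^ b ≤ c ^ b :=
        pow_le_pow_left₀ (mul_nonneg hc hv.1) (mul_le_of_le_one_right hc hv.2) b
      have h2 := div_le_div_of_nonneg_right h1 (Nat.cast_nonneg (α := ℝ) b.factorial)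
      linarith)
  simpa [poissonIntegral] using h

/-- A Riemann sum in `v = log (t / m)`, with mesh `log (n + 1) - log n`. Replacing `1 / n` by the
mesh costs at most `1 / n - 1 / (n + 1)`, and the Taylor remainder `c * p ^ 2` at most `2 * c` times
that; both telescope. -/
theorem abs_sum_inv_mul_poissonLt_sub_le (b : ℕ) {c : ℝ} (hc : 0 ≤ c) {m n : ℕ} (hm : 1 ≤ m)
    (hmn : m ≤ n) :
    |∑ t ∈ Ico m n, 1 / (t : ℝ) * poissonLt b (c * Real.log (t / m)) -
        poissonIntegral b c (Real.log (n / m))| ≤ (1 + 2 * c) / m := by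
  have hm0 : (0 : ℝ) < m := by exact_mod_cast hm
  have main : |∑ t ∈ Ico m n, 1 / (t : ℝ) * poissonLt b (c * Real.log (t / m)) -
        poissonIntegral b c (Real.log (n / m))| ≤ (1 + 2 * c) * (1 / m - 1 / n) := by
    induction n, hmn using Nat.le_induction with
    | base => simp [poissonIntegral, hm0.ne']
    | succ n hmn ih =>
      have hn1 : (1 : ℝ) ≤ n := by exact_mod_cast hm.trans hmn
      have hn0 : (0 : ℝ) < n := by linarith
      rw [sum_Ico_succ_top hmn]
      push_cast
      set a := Real.log ((n : ℝ) / m) with ha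
      set p := Real.log ((n : ℝ) + 1) - Real.log n with hp
      have hlog : Real.log (((n : ℝ) + 1) / m) = a + p := by
        rw [ha, hp, Real.log_div (by positivity) hm0.ne', Real.log_div hn0.ne' hm0.ne']
        ring
      rw [hlog]
      have ha0 : 0 ≤ a := Real.log_nonneg (by rw [one_le_div hm0]; exact_mod_cast hmn)
      have hp0 : 0 ≤ p := sub_nonneg.2 (Real.log_le_log hn0 (by linarith))
      have h1 := abs_inv_succ_sub_log_le hn0
      have hpn : p ≤ 1 / n := by
        have := (abs_le.1 h1).1
        rw [hp]; linarith
      have hpn' : 1 / ((n : ℝ) + 1) ≤ p := by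
        have h2 := Real.one_sub_inv_le_log_of_pos (x := ((n : ℝ) + 1) / n) (by positivity)
        have e1 : 1 - (((n : ℝ) + 1) / n)⁻¹ = 1 / ((n : ℝ) + 1) := by field_simp; ring
        rwa [e1, Real.log_div (by positivity) hn0.ne'] at h2
      have hp2 : p ^ 2 ≤ 2 * (1 / (n : ℝ) - 1 / ((n : ℝ) + 1)) := by
        have e : 2 * (1 / (n : ℝ) - 1 / ((n : ℝ) + 1)) - (1 / (n : ℝ)) ^ 2 =
            (n - 1) / (n ^ 2 * (n + 1)) := by field_simp; ring
        have e' : 0 ≤ ((n : ℝ) - 1) / (n ^ 2 * (n + 1)) :=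
          div_nonneg (by linarith) (by positivity)
        have := pow_le_pow_left₀ hp0 hpn 2
        linarith
      have h3 := abs_sub_sub_le_of_lipschitz_deriv (f := poissonIntegral b c)
        (f' := fun y => poissonLt b (c * y)) (C := c)
        (fun y _ => hasDerivAt_poissonIntegral b c y) (fun y z hy hyz => by
          have := abs_poissonLt_sub_le b (mul_nonneg hc hy) (mul_nonneg hc (hy.trans hyz))
          rwa [← mul_sub, abs_of_nonneg (mul_nonneg hc (sub_nonneg.2 hyz))] at this) ha0 hp0 hc
      have h4 : |(1 / (n : ℝ) - p) * poissonLt b (c * a)| ≤ 1 / (n : ℝ) - 1 / ((n : ℝ) + 1) := by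
        have hq0 := poissonLt_nonneg b (mul_nonneg hc ha0)
        have hq1 := poissonLt_le_one b (mul_nonneg hc ha0)
        rw [abs_of_nonneg (mul_nonneg (by linarith) hq0)]
        calc _ ≤ 1 / (n : ℝ) - p := mul_le_of_le_one_right (by linarith) hq1
          _ ≤ _ := by linarith
      have h5 := mul_le_mul_of_nonneg_left hp2 hc
      rw [abs_le] at ih h3 h4 ⊢
      constructor <;> nlinarith [ih.1, ih.2, h3.1, h3.2, h4.1, h4.2]
  refine main.trans ?_
  have : (0 : ℝ) ≤ 1 / n := by positivity
  calc (1 + 2 * c) * (1 / (m : ℝ) - 1 / n) ≤ (1 + 2 * c) * (1 / m) :=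
        mul_le_mul_of_nonneg_left (by linarith) (by linarith)
    _ = (1 + 2 * c) / m := by ring

/-! ### The success probability for finite `N`. -/

theorem sum_fin_ite_le_eq_sum_Ico (N m : ℕ) (f : ℕ → ℝ) :
    (∑ t : Fin N, if m ≤ (t : ℕ) then f t else 0) = ∑ t ∈ Ico m N, f t := by
  rw [Fin.sum_univ_eq_sum_range (fun t => if m ≤ t then f t else 0) N, ← sum_filter]
  congr 1
  ext t
  simp [and_comm]

theorem sum_fin_ite_lt_const {N m : ℕ} (hmN : m ≤ N) (c : ℝ) :
    (∑ s : Fin N, if (s : ℕ) < m then c else 0) = m * c := by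
  rw [← sum_filter, sum_const, Fin.card_filter_val_lt, min_eq_right hmN, nsmul_eq_mul]

/-- Quantitative approximation of the success probability. -/
theorem abs_successProb_sub_le {K : ℕ} (lam : Fin K → ℝ) (hpos : ∀ k, 0 < lam k)
    (hsum : ∑ k, lam k = 1) (hK : 1 ≤ K) {ℓ ε : ℝ} (hℓ : 0 < ℓ) (hlam : ∀ k, ℓ ≤ lam k)
    (hε0 : 0 < ε) (hε : ε ≤ 1 / 2) (B : ℕ) {N m : ℕ} (hm : 1 ≤ m) (hmN : m ≤ N) :
    |successProb lam B N (m + 1) -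
        m / N * poissonIntegral (B + 1) ((K : ℝ) - 1) (Real.log (N / m))| ≤
      K * (4 * ε + 6 / (ℓ * m)) + 2 * (K * (1 / (ε ^ 2 * (ℓ * m)))) +
        (1 + 2 * ((K : ℝ) - 1)) / m := by
  have hm0 : (0 : ℝ) < m := by exact_mod_cast hm
  have hmN' : (m : ℝ) ≤ N := by exact_mod_cast hmN
  have hN0 : (0 : ℝ) < N := hm0.trans_le hmN'
  have hc : 0 ≤ (K : ℝ) - 1 := by
    have : (1 : ℝ) ≤ K := by exact_mod_cast hK
    linarith
  set δ : ℝ := K * (4 * ε + 6 / (ℓ * m)) + 2 * (K * (1 / (ε ^ 2 * (ℓ * m)))) with hδ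
  have hδ0 : 0 ≤ δ := by positivity
  let Q : ℕ → ℝ := fun t => poissonLt (B + 1) (((K : ℝ) - 1) * Real.log (t / m))
  have hR := abs_sum_inv_mul_poissonLt_sub_le (B + 1) hc hm hmN
  have hdouble : ∀ f : ℕ → ℝ, (∑ t : Fin N, ∑ s : Fin N, if m ≤ (t : ℕ) ∧ (s : ℕ) < m then
      f t else 0) = ∑ t ∈ Ico m N, m * f t := by
    intro f
    rw [← sum_fin_ite_le_eq_sum_Ico]
    refine sum_congr rfl fun t _ => ?_
    by_cases h : m ≤ (t : ℕ)
    · simp only [h, true_and, if_true, sum_fin_ite_lt_const hmN]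
    · simp [h]
  have hmain : (m : ℝ) / N * ∑ t ∈ Ico m N, 1 / (t : ℝ) * Q t =
      ∑ t : Fin N, ∑ s : Fin N, if m ≤ (t : ℕ) ∧ (s : ℕ) < m then
        1 / (N : ℝ) * (1 / (t : ℝ)) * Q t else 0 := by
    rw [hdouble fun t => 1 / (N : ℝ) * (1 / (t : ℝ)) * Q t, mul_sum]
    refine sum_congr rfl fun t _ => ?_
    ring
  have herr : |successProb lam B N (m + 1) - (m : ℝ) / N * ∑ t ∈ Ico m N, 1 / (t : ℝ) * Q t| ≤
      δ := by
    rw [hmain, successProb_eq lam B N m hm, ← sum_sub_distrib]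
    calc _ ≤ ∑ t : Fin N, ∑ s : Fin N, if m ≤ (t : ℕ) ∧ (s : ℕ) < m then
          1 / (N : ℝ) * (1 / (t : ℝ)) * δ else 0 := by
          refine (abs_sum_le_sum_abs _ _).trans (sum_le_sum fun t _ => ?_)
          rw [← sum_sub_distrib]
          refine (abs_sum_le_sum_abs _ _).trans (sum_le_sum fun s _ => ?_)
          by_cases h : m ≤ (t : ℕ) ∧ (s : ℕ) < m
          · simp only [if_pos h]
            rw [← mul_sub, abs_mul, abs_of_nonneg (by positivity)]
            exact mul_le_mul_of_nonneg_left (abs_sum_weight_recordProb_sub_le lam hpos hsum hℓ hlam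
              hε0 hε s (B + 1) hm h.1 t.2.le) (by positivity)
          · simp only [if_neg h, sub_zero, abs_zero, le_refl]
      _ = ∑ t ∈ Ico m N, m * (1 / (N : ℝ) * (1 / (t : ℝ)) * δ) :=
          hdouble fun t => 1 / (N : ℝ) * (1 / (t : ℝ)) * δ
      -- The weights `1 / (N t)` over `s < m ≤ t` have total mass at most `1`, so a uniform error
      -- `δ` stays at most `δ`.
      _ ≤ ∑ t ∈ Ico m N, 1 / (N : ℝ) * δ := by
          refine sum_le_sum fun t ht => ?_
          have hmt : (m : ℝ) ≤ t := by exact_mod_cast (mem_Ico.1 ht).1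
          have h1 : (m : ℝ) * (1 / t) ≤ 1 := by
            rw [mul_one_div, div_le_one (hm0.trans_le hmt)]; exact hmt
          calc m * (1 / (N : ℝ) * (1 / (t : ℝ)) * δ) = m * (1 / (t : ℝ)) * (1 / (N : ℝ) * δ) := by
                ring
            _ ≤ 1 * (1 / (N : ℝ) * δ) := mul_le_mul_of_nonneg_right h1 (by positivity)
            _ = _ := one_mul _
      _ ≤ N * (1 / (N : ℝ) * δ) := by
          rw [sum_const, Nat.card_Ico, nsmul_eq_mul]
          refine mul_le_mul_of_nonneg_right ?_ (by positivity)
          exact_mod_cast Nat.sub_le N m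
      _ = δ := by field_simp
  have hratio : |(m : ℝ) / N * ∑ t ∈ Ico m N, 1 / (t : ℝ) * Q t -
      m / N * poissonIntegral (B + 1) ((K : ℝ) - 1) (Real.log (N / m))| ≤
      (1 + 2 * ((K : ℝ) - 1)) / m := by
    rw [← mul_sub, abs_mul, abs_of_nonneg (by positivity)]
    calc _ ≤ 1 * ((1 + 2 * ((K : ℝ) - 1)) / m) :=
          mul_le_mul ((div_le_one hN0).2 hmN') hR (abs_nonneg _) zero_le_one
      _ = _ := one_mul _
  exact (abs_sub_le _ _ _).trans (add_le_add herr hratio)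

/-! ### Passage to the limit at the threshold `⌊N / e⌋`. -/

open Filter Topology

/-- The subtracted `1` converts the 1-based threshold to a 0-based step; `N ≥ 3` exceeds `e`, so the
truncated subtraction is a true one. -/
theorem tendsto_threshold_div :
    Tendsto (fun N : ℕ => ((⌊(N : ℝ) / Real.exp 1⌋₊ - 1 : ℕ) : ℝ) / N) atTop
      (𝓝 (1 / Real.exp 1)) := by
  have h1 : Tendsto (fun N : ℕ => (⌊1 / Real.exp 1 * (N : ℝ)⌋₊ : ℝ) / N) atTop
      (𝓝 (1 / Real.exp 1)) :=
    (tendsto_nat_floor_mul_div_atTop (by positivity)).comp tendsto_natCast_atTop_atTop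
  have h2 : Tendsto (fun N : ℕ => 1 / (N : ℝ)) atTop (𝓝 0) := tendsto_one_div_atTop_nhds_zero_nat
  have h3 := h1.sub h2
  rw [sub_zero] at h3
  refine h3.congr' ?_
  filter_upwards [eventually_ge_atTop 3] with N hN
  have he : Real.exp 1 < 3 := Real.exp_one_lt_three
  have hfl : 1 ≤ ⌊(N : ℝ) / Real.exp 1⌋₊ := by
    rw [Nat.one_le_floor_iff, one_le_div (Real.exp_pos 1)]
    have : (3 : ℝ) ≤ N := by exact_mod_cast hN
    linarith
  rw [Nat.cast_sub hfl, one_div_mul_eq_div]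
  push_cast
  ring

theorem tendsto_threshold :
    Tendsto (fun N : ℕ => ((⌊(N : ℝ) / Real.exp 1⌋₊ - 1 : ℕ) : ℝ)) atTop atTop := by
  have h := tendsto_threshold_div.pos_mul_atTop (by positivity)
    (tendsto_natCast_atTop_atTop (R := ℝ))
  refine h.congr' ?_
  filter_upwards [eventually_gt_atTop 0] with N hN
  have : (N : ℝ) ≠ 0 := by positivity
  field_simp

theorem tendsto_successProb {K : ℕ} (lam : Fin K → ℝ) (hpos : ∀ k, 0 < lam k)
    (hsum : ∑ k, lam k = 1) (hK : 1 ≤ K) (B : ℕ) :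
    Tendsto (fun N : ℕ => successProb lam B N ⌊(N : ℝ) / Real.exp 1⌋₊) atTop
      (𝓝 (1 / Real.exp 1 * poissonIntegral (B + 1) ((K : ℝ) - 1) 1)) := by
  have : Nonempty (Fin K) := ⟨⟨0, hK⟩⟩
  obtain ⟨k₀, hk₀⟩ := Finite.exists_min lam
  have hK0 : (0 : ℝ) < K := by exact_mod_cast hK
  set ℓ := lam k₀ with hℓ
  have hℓ0 : 0 < ℓ := hpos k₀
  let m : ℕ → ℕ := fun N => ⌊(N : ℝ) / Real.exp 1⌋₊ - 1
  let main : ℕ → ℝ := fun N =>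
    (m N : ℝ) / N * poissonIntegral (B + 1) ((K : ℝ) - 1) (Real.log (N / m N))
  have hmain : Tendsto main atTop
      (𝓝 (1 / Real.exp 1 * poissonIntegral (B + 1) ((K : ℝ) - 1) 1)) := by
    refine tendsto_threshold_div.mul ?_
    have hlog : Tendsto (fun N : ℕ => Real.log ((N : ℝ) / m N)) atTop (𝓝 1) := by
      have h := (tendsto_threshold_div.inv₀ (by positivity)).log (by positivity)
      simp only [one_div, inv_inv, Real.log_exp, inv_div] at h
      exact h
    exact (hasDerivAt_poissonIntegral _ _ 1).continuousAt.tendsto.comp hlog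
  have hdiff : Tendsto (fun N : ℕ => successProb lam B N ⌊(N : ℝ) / Real.exp 1⌋₊ - main N) atTop
      (𝓝 0) := by
    rw [Metric.tendsto_nhds]
    intro η hη
    -- First `ε` is fixed so that the error not vanishing with `m` is at most `η / 2`; for this `ε`,
    -- every other error is a constant over `m` and eventually falls below `η / 2`.
    obtain ⟨ε, hε0, hε, hεη⟩ : ∃ ε : ℝ, 0 < ε ∧ ε ≤ 1 / 2 ∧ K * (4 * ε) ≤ η / 2 := by
      refine ⟨min (1 / 2) (η / (8 * K)), by positivity, min_le_left _ _, ?_⟩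
      calc (K : ℝ) * (4 * min (1 / 2) (η / (8 * K))) ≤ K * (4 * (η / (8 * K))) := by
            gcongr; exact min_le_right _ _
        _ = η / 2 := by field_simp; ring
    have hC := (tendsto_const_nhds (x := (K : ℝ) * 6 / ℓ + 2 * (K / (ε ^ 2 * ℓ)) +
      (1 + 2 * ((K : ℝ) - 1)))).div_atTop tendsto_threshold
    filter_upwards [hC.eventually_lt_const (half_pos hη), tendsto_threshold.eventually_ge_atTop 1]
      with N hN hmN
    have hm1 : 1 ≤ m N := by exact_mod_cast hmN
    have hmN' : m N ≤ N := by
      have h1 : ⌊(N : ℝ) / Real.exp 1⌋₊ ≤ N := by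
        refine Nat.floor_le_of_le ?_
        exact div_le_self (Nat.cast_nonneg N) (Real.one_le_exp zero_le_one)
      exact (Nat.sub_le _ _).trans h1
    have hT : ⌊(N : ℝ) / Real.exp 1⌋₊ = m N + 1 := by simp only [m] at hm1 ⊢; omega
    have hm0 : (0 : ℝ) < m N := by exact_mod_cast hm1
    rw [Real.dist_eq, sub_zero, hT]
    refine (abs_successProb_sub_le lam hpos hsum hK hℓ0 hk₀ hε0 hε B hm1 hmN').trans_lt ?_
    have e : (K : ℝ) * (4 * ε + 6 / (ℓ * m N)) + 2 * (K * (1 / (ε ^ 2 * (ℓ * m N)))) +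
        (1 + 2 * ((K : ℝ) - 1)) / m N = K * (4 * ε) +
        ((K : ℝ) * 6 / ℓ + 2 * (K / (ε ^ 2 * ℓ)) + (1 + 2 * ((K : ℝ) - 1))) / m N := by
      field_simp
      ring
    rw [e]
    change _ / (m N : ℝ) < _ at hN
    linarith
  simpa using hdiff.add hmain

end Secretary

/-! ### The main theorem. -/

theorem mainTheorem2 (K : ℕ) (lam : Fin K → ℝ) (hpos : ∀ k, 0 < lam k) (hsum : ∑ k, lam k = 1) :
    ∃ L : ℕ → ℝ,
      (∀ B : ℕ, Filter.Tendsto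
        (fun N : ℕ => Secretary.successProb lam B N ⌊(N : ℝ) / Real.exp 1⌋₊)
        Filter.atTop (nhds (L B))) ∧
      (∀ B : ℕ,
        (1 / Real.exp 1) * (1 - ((K : ℝ) - 1) ^ (B + 1) / (Nat.factorial (B + 1) : ℝ)) ≤ L B) ∧
      (∀ B : ℕ,
        |L B - 1 / Real.exp 1| ≤
          (1 / Real.exp 1) * (((K : ℝ) - 1) ^ (B + 1) / (Nat.factorial (B + 1) : ℝ))) ∧
      (∀ B : ℕ, L B ≤ 1 / Real.exp 1) ∧
      Filter.Tendsto L Filter.atTop (nhds (1 / Real.exp 1)) := by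
  have hK : 1 ≤ K := by
    rcases Nat.eq_zero_or_pos K with rfl | h
    · simp at hsum
    · exact h
  have hc : 0 ≤ (K : ℝ) - 1 := by
    have : (1 : ℝ) ≤ K := by exact_mod_cast hK
    linarith
  have he : 0 < 1 / Real.exp 1 := by positivity
  let L : ℕ → ℝ := fun B => 1 / Real.exp 1 * Secretary.poissonIntegral (B + 1) ((K : ℝ) - 1) 1
  have hlow : ∀ B : ℕ, (1 / Real.exp 1) *
      (1 - ((K : ℝ) - 1) ^ (B + 1) / (Nat.factorial (B + 1) : ℝ)) ≤ L B := fun B =>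
    mul_le_mul_of_nonneg_left (Secretary.le_poissonIntegral_one hc) he.le
  have hup : ∀ B : ℕ, L B ≤ 1 / Real.exp 1 := fun B =>
    mul_le_of_le_one_right he.le (Secretary.poissonIntegral_one_le hc)
  have habs : ∀ B : ℕ, |L B - 1 / Real.exp 1| ≤
      (1 / Real.exp 1) * (((K : ℝ) - 1) ^ (B + 1) / (Nat.factorial (B + 1) : ℝ)) := by
    intro B
    rw [abs_sub_comm, abs_of_nonneg (sub_nonneg.2 (hup B))]
    linarith [hlow B]
  refine ⟨L, Secretary.tendsto_successProb lam hpos hsum hK, hlow, habs, hup, ?_⟩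
  have h0 : Filter.Tendsto (fun B : ℕ => (1 / Real.exp 1) *
      (((K : ℝ) - 1) ^ (B + 1) / (Nat.factorial (B + 1) : ℝ))) Filter.atTop (nhds 0) := by
    have h := (FloorSemiring.tendsto_pow_div_factorial_atTop ((K : ℝ) - 1)).comp
      (Filter.tendsto_add_atTop_nat 1)
    simpa using h.const_mul (1 / Real.exp 1)
  rw [tendsto_iff_dist_tendsto_zero]
  exact squeeze_zero (fun B => dist_nonneg) habs h0
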